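/- Let $T$ be any first-order theory and let $\mathbb M\models T$ be a monster model: $\mathbb M$ is $\kappa$-saturated and strongly $\kappa$-homogeneous for some uncountable cardinal $\kappa$. "Small" means of cardinality $<\kappa$; a small model is a small elementary submodel of $\mathbb M$. We consider relations $A\perp_M B$, where $M$ is a small model and $A,B\supseteq M$ are small subsets of $\mathbb M$; for tuples $a,b$, $a\perp_M b$ means $Ma\perp_M Mb$. Write $A\perp^u_M B$ if every formula of $\mathrm{tp}(A/MB)$ is satisfiable in $M$, and $A\perp^h_M B$ if $B\perp^u_M A$. A *coheir Morley sequence over $M$* is a sequence $(b_i)_{i<\omega}$ of tuples for which there is a global type $p$ (a complete type over $\mathbb M$) finitely satisfiable in $M$ with $b_i\models p|_{M\{b_j: j<i\}}$ for all $i$. Call a relation $\perp$ *admissible* if it satisfies the following, for all small models $M$ and all small sets $A,B,C \supseteq M$. * *Stronger than $\perp^h$*: $A\perp_M B$ implies $A\perp^h_M B$. * *Invariance*: $A\perp_M B$ implies $\sigma(A)\perp_{\sigma(M)}\sigma(B)$ for all $\sigma\in\mathrm{Aut}(\mathbb M)$. * *Monotonicity*: if $A\perp_M B$, $M\subseteq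 A'\subseteq A$ and $M\subseteq B'\subseteq B$, then $A'\perp_M B$ and $A\perp_M B'$. * *Existence*: there is $A'\equiv_M A$ with $A'\perp_M B$. * *Right extension*: if $A\perp_M B$ and $B\subseteq C$, there is $A'\equiv_B A$ with $A'\perp_M C$. * *Coheir chain condition*: if $A\perp_M b$ and $I=(b_i)_{i<\omega}$ is a coheir Morley sequence over $M$ of small tuples with $b_0=b$, there is $I'\equiv_M I$ with $A\perp_M I'$ and each term of $I'$ satisfying $\mathrm{tp}(b/A)$. For a relation $\perp$, define a relation $\perp'$ as follows. Let $P(x)$ be a complete type over $M$ in a (possibly infinite) tuple of variables. A formula $\varphi(x,b)$, with $b$ a finite tuple in $\mathbb M$, *$h^{\perp}$-Kim-divides with respect to $P$* if there is a coheir Morley sequence $(b_i)_{i<\omega}$ over $M$ with $b_0=b$ such that no $a\models P$ satisfies both $a\perp_M \{b_i\}_{i<\omega}$ and $\models\varphi(a,b_i)$ for all $i$. It *$h^{\perp}$-Kim-forks with respect to $P$* if it implies a finite disjunction of formulas that $h^{\perp}$-Kim-divide with respect to $P$. Let $A\perp'_M B$ mean that $\mathrm{tp}(A/B)$ contains no formula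 that $h^{\perp}$-Kim-forks with respect to $\mathrm{tp}(A/M)$. Put $\perp^{(0)}=\perp^h$, $\perp^{(n+1)}=(\perp^{(n)})'$ and $\perp^{\mathrm{CK}}=\bigcap_{n}\perp^{(n)}$. Then $\perp^{\mathrm{CK}}$ is the weakest admissible relation: it is admissible, and for every admissible relation $\perp$, $A\perp_M B$ implies $A\perp^{\mathrm{CK}}_M B$ for all small models $M$ and all small $A,B\supseteq M$. -/

import Mathlib

open FirstOrder FirstOrder.Language

universe u v w

namespace CanonicalCoheir

section Basics

variable (L : FirstOrder.Language.{u, v}) {𝕄 : Type w} [L.Structure 𝕄]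

/-- `𝕄` is `κ`-saturated: a set of formulas in one variable over fewer than `κ` parameters that is
finitely satisfiable in `𝕄` is realized in `𝕄`. -/
def IsSaturated (𝕄 : Type w) [L.Structure 𝕄] (κ : Cardinal.{w}) : Prop :=
  ∀ A : Set 𝕄, Cardinal.mk A < κ → ∀ p : Set (L[[A]].Formula Unit),
    (∀ s : Finset (L[[A]].Formula Unit), ↑s ⊆ p → ∃ x : Unit → 𝕄, ∀ φ ∈ s, φ.Realize x) →
      ∃ x : Unit → 𝕄, ∀ φ ∈ p, φ.Realize x

/-- `𝕄` is strongly `κ`-homogeneous: a partial elementary map defined on fewer than `κ` elements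
extends to an automorphism. -/
def IsStronglyHomogeneous (𝕄 : Type w) [L.Structure 𝕄] (κ : Cardinal.{w}) : Prop :=
  ∀ (A : Set 𝕄) (f : A → 𝕄), Cardinal.mk A < κ →
    (∀ φ : L.Formula A, φ.Realize (Subtype.val : A → 𝕄) ↔ φ.Realize f) →
      ∃ σ : 𝕄 ≃[L] 𝕄, ∀ a : A, σ a = f a

/-- `M` is (the universe of) a small elementary submodel of `𝕄`. -/
def IsSmallModel (κ : Cardinal.{w}) (M : Set 𝕄) : Prop :=
  (∃ S : L.ElementarySubstructure 𝕄, (S : Set 𝕄) = M) ∧ Cardinal.mk M < κ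

/-- The tuples `a` and `a'` have the same type over `A`, that is `a ≡_A a'`. -/
def SameType {α : Type*} (A : Set 𝕄) (a a' : α → 𝕄) : Prop :=
  ∀ φ : L[[A]].Formula α, φ.Realize a ↔ φ.Realize a'

/-- `A ⫝ᵘ_M B`: every formula of `tp(A/MB)` is satisfiable in `M`. -/
def IndU (M A B : Set 𝕄) : Prop :=
  ∀ φ : L[[(M ∪ B : Set 𝕄)]].Formula A, φ.Realize (Subtype.val : A → 𝕄) →
    ∃ c : A → 𝕄, (∀ i, c i ∈ M) ∧ φ.Realize c

/-- `A ⫝ʰ_M B`, which means `B ⫝ᵘ_M A`. -/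
def IndH (M A B : Set 𝕄) : Prop := IndU L M B A

/-- A global type: a complete type over `𝕄`, in variables indexed by `ι`. -/
abbrev GlobalType (𝕄 : Type w) [L.Structure 𝕄] (ι : Type*) :=
  (L.elementaryDiagram 𝕄).CompleteType ι

variable {L}

/-- The global type `p` is finitely satisfiable in `M`: each of its formulas is satisfiable
in `M`. -/
def FinitelySatisfiableIn {ι : Type*} (p : GlobalType L 𝕄 ι) (M : Set 𝕄) : Prop :=
  ∀ φ : L[[𝕄]].Formula ι, Formula.equivSentence φ ∈ p →
    ∃ c : ι → 𝕄, (∀ i, c i ∈ M) ∧ φ.Realize c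

/-- `b` realizes the restriction of the global type `p` to the parameter set `A`. -/
def RealizesRestriction {ι : Type*} (p : GlobalType L 𝕄 ι) (A : Set 𝕄) (b : ι → 𝕄) : Prop :=
  ∀ φ : L[[A]].Formula ι,
    Formula.equivSentence ((L.lhomWithConstantsMap (Subtype.val : A → 𝕄)).onFormula φ) ∈ p →
      φ.Realize b

variable (L)

/-- `(b i)` is a coheir Morley sequence over `M`: for a fixed global type `p` finitely satisfiable
in `M`, each `b i` realizes the restriction of `p` to `M ∪ {b j : j < i}`. -/
def IsCoheirMorley {ι : Type*} (M : Set 𝕄) (b : ℕ → ι → 𝕄) : Prop :=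
  ∃ p : GlobalType L 𝕄 ι, FinitelySatisfiableIn p M ∧
    ∀ i, RealizesRestriction p (M ∪ ⋃ j, ⋃ _ : j < i, Set.range (b j)) (b i)

end Basics

section Relations

variable (L : FirstOrder.Language.{u, v}) {𝕄 : Type w} [L.Structure 𝕄]

/-- A ternary relation, where `R M A B` is read as `A ⫝_M B`. It is only considered at those triples
which satisfy `IsTriple` below. For tuples `a` and `b`, `a ⫝_M b` means that
`R M (M ∪ Set.range a) (M ∪ Set.range b)`. -/
abbrev Relation (𝕄 : Type w) := Set 𝕄 → Set 𝕄 → Set 𝕄 → Prop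

/-- `A` and `B` are small sets containing the small model `M`. -/
structure IsTriple (κ : Cardinal.{w}) (M A B : Set 𝕄) : Prop where
  model : IsSmallModel L κ M
  left : M ⊆ A
  right : M ⊆ B
  left_small : Cardinal.mk A < κ
  right_small : Cardinal.mk B < κ

def Invariance (κ : Cardinal.{w}) (R : Relation 𝕄) : Prop :=
  ∀ (σ : 𝕄 ≃[L] 𝕄) (M A B : Set 𝕄), IsTriple L κ M A B →
    R M A B → R (σ '' M) (σ '' A) (σ '' B)

def LeftMonotonicity (κ : Cardinal.{w}) (R : Relation 𝕄) : Prop :=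
  ∀ M A A' B : Set 𝕄, IsTriple L κ M A B → M ⊆ A' → A' ⊆ A → R M A B → R M A' B

def RightMonotonicity (κ : Cardinal.{w}) (R : Relation 𝕄) : Prop :=
  ∀ M A B B' : Set 𝕄, IsTriple L κ M A B → M ⊆ B' → B' ⊆ B → R M A B → R M A B'

/-- There is always some `A' ≡_M A` with `A' ⫝_M B`. -/
def Existence (κ : Cardinal.{w}) (R : Relation 𝕄) : Prop :=
  ∀ M A B : Set 𝕄, IsTriple L κ M A B →
    ∃ f : A → 𝕄, SameType L M (Subtype.val : A → 𝕄) f ∧ R M (Set.range f) B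

/-- If `A ⫝_M B` and `B ⊆ C`, there is some `A' ≡_B A` with `A' ⫝_M C`. -/
def RightExtension (κ : Cardinal.{w}) (R : Relation 𝕄) : Prop :=
  ∀ M A B C : Set 𝕄, IsTriple L κ M A B → B ⊆ C → Cardinal.mk C < κ → R M A B →
    ∃ f : A → 𝕄, SameType L B (Subtype.val : A → 𝕄) f ∧ R M (Set.range f) C

/-- If `A ⫝_M b` and `I = (b i)` is a coheir Morley sequence over `M` of small tuples with
`b 0 = b`, there is some `I' = (b' i) ≡_M I` with `A ⫝_M I'` and each `b' i` realizing
`tp(b/A)`. -/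
def CoheirChainCondition (κ : Cardinal.{w}) (R : Relation 𝕄) : Prop :=
  ∀ (M A : Set 𝕄) (ι : Type w) (b : ℕ → ι → 𝕄),
    IsTriple L κ M A (M ∪ Set.range (b 0)) → Cardinal.mk ι < κ → IsCoheirMorley L M b →
    R M A (M ∪ Set.range (b 0)) →
    ∃ b' : ℕ → ι → 𝕄,
      SameType L M (fun k : ℕ × ι => b k.1 k.2) (fun k : ℕ × ι => b' k.1 k.2) ∧
      R M A (M ∪ ⋃ i, Set.range (b' i)) ∧
      ∀ i, SameType L A (b 0) (b' i)

/-- The relations between sets over a model which are considered. -/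
structure IsCanonicalCandidate (κ : Cardinal.{w}) (R : Relation 𝕄) : Prop where
  stronger : ∀ M A B : Set 𝕄, IsTriple L κ M A B → R M A B → IndH L M A B
  invariance : Invariance L κ R
  left_monotonicity : LeftMonotonicity L κ R
  right_monotonicity : RightMonotonicity L κ R
  existence : Existence L κ R
  right_extension : RightExtension L κ R
  coheir_chain : CoheirChainCondition L κ R

end Relations

section Construction

variable {L : FirstOrder.Language.{u, v}} {𝕄 : Type w} [L.Structure 𝕄]

/-- The set `{φ(x, b i)}` is `h`-inconsistent for `R` with respect to `P(x) = tp(a/M)`: there is no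
realization `a'` of `P` such that `a' ⫝_M {b i}` and all `φ(a', b i)` hold. -/
def HInconsistent (R : Relation 𝕄) (M : Set 𝕄) {α : Type*} (a : α → 𝕄) {n : ℕ}
    (φ : L.Formula (α ⊕ Fin n)) {I : Type*} (b : I → Fin n → 𝕄) : Prop :=
  ¬ ∃ a' : α → 𝕄, SameType L M a a' ∧
    R M (M ∪ Set.range a') (M ∪ ⋃ i, Set.range (b i)) ∧
    ∀ i, φ.Realize (Sum.elim a' (b i))

/-- `φ(x, b)` `h`-Kim-divides for `R` with respect to `tp(a/M)`. -/
def HKimDivides (R : Relation 𝕄) (M : Set 𝕄) {α : Type*} (a : α → 𝕄) {n : ℕ}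
    (φ : L.Formula (α ⊕ Fin n)) (b : Fin n → 𝕄) : Prop :=
  ∃ c : ℕ → Fin n → 𝕄, IsCoheirMorley L M c ∧ c 0 = b ∧ HInconsistent R M a φ c

/-- `φ(x, b)` `h`-Kim-forks for `R` with respect to `tp(a/M)`: it implies a finite disjunction of
formulas which `h`-Kim-divide for `R` with respect to `tp(a/M)`. -/
def HKimForks (R : Relation 𝕄) (M : Set 𝕄) {α : Type*} (a : α → 𝕄) {n : ℕ}
    (φ : L.Formula (α ⊕ Fin n)) (b : Fin n → 𝕄) : Prop :=
  ∃ (k : ℕ) (m : Fin k → ℕ) (ψ : ∀ j, L.Formula (α ⊕ Fin (m j))) (c : ∀ j, Fin (m j) → 𝕄),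
    (∀ j, HKimDivides R M a (ψ j) (c j)) ∧
    ∀ x : α → 𝕄, φ.Realize (Sum.elim x b) → ∃ j, (ψ j).Realize (Sum.elim x (c j))

variable (L)

/-- The derived relation `A ⫝'_M B`: no formula of `tp(A/B)` `h`-Kim-forks for `R` with respect to
`tp(A/M)`. (Here `B` contains `M`, so that parameters in `M` are allowed.) -/
def derived (R : Relation 𝕄) : Relation 𝕄 := fun M A B =>
  ∀ (n : ℕ) (φ : L.Formula (A ⊕ Fin n)) (b : Fin n → 𝕄), (∀ i, b i ∈ B) →
    φ.Realize (Sum.elim (Subtype.val : A → 𝕄) b) →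
      ¬ HKimForks R M (Subtype.val : A → 𝕄) φ b

/-- The iterated construction, starting from `⫝ʰ`. -/
def iter : ℕ → Relation 𝕄
  | 0 => IndH L
  | n + 1 => derived L (iter n)

/-- `A ⫝ᶜᴷ_M B`: the intersection of the iterates. -/
def IndCK : Relation 𝕄 := fun M A B => ∀ n, iter L n M A B

end Construction

end CanonicalCoheir

/-! Types are handled as filters on spaces of tuples: a global type finitely satisfiable in `M` is
the average type of an ultrafilter concentrating on tuples from `M`, and realizing its restriction
to `A` is `Generic`. Saturation realizes such ultrafilters, and homogeneity turns equality of types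
into automorphisms.

All iterates are `IsGood`. Here the chain condition is replaced by locality: independence is a
closed condition on the type of the left side, tested on finitely many parameters. The hard point in
passing from `R` to its derived relation is existence, which reduces to `derived_self`: an
`M`-definable set containing `A` cannot be covered by finitely many dividing formulas. The
combinatorial core is `exists_broom`. It gives finitely many conjugates over `M` of the concatenated
parameters such that, however they are coloured by the disjuncts, some colour contains a long Morley
sequence in its own coheir. A copy of `A` that is `R`-independent from the whole broom colours each
conjugate by a disjunct true there. The resulting branch contradicts dividing, because inconsistency
along a Morley sequence is already visible at a finite length.

The chain condition costs one level: independence at level `n + 1` from the first term gives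
independence at level `n` from the sequence. The intersection absorbs this loss, by compactness over
all levels at once (`exists_equiv_of_isLocal`).

For maximality, let an admissible relation be stronger than `S`. Right extension makes `A`
independent from the parameters of a supposed forking disjunction, and the chain condition then
contradicts dividing of the disjunct that holds. So the relation is stronger than the derived
relation of `S`, and induction covers all iterates. -/

namespace CanonicalCoheir

open Set

/-! ### Definable sets of possibly infinite tuples, and types -/

section DefinableSets

variable {L : FirstOrder.Language.{u, v}} {𝕄 : Type w} [L.Structure 𝕄]
variable {α β γ : Type*} {A B M : Set 𝕄}

/-- The automorphism `σ` fixes `A` pointwise. -/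
def Fixes (σ : 𝕄 ≃[L] 𝕄) (A : Set 𝕄) : Prop := ∀ x ∈ A, σ x = x

theorem Fixes.mono {σ : 𝕄 ≃[L] 𝕄} (h : Fixes σ B) (hAB : A ⊆ B) : Fixes σ A :=
  fun x hx => h x (hAB hx)

theorem Fixes.symm {σ : 𝕄 ≃[L] 𝕄} (h : Fixes σ A) : Fixes σ.symm A := fun x hx => by
  conv_lhs => rw [← h x hx]
  exact σ.symm_apply_apply x

theorem Fixes.comp {σ τ : 𝕄 ≃[L] 𝕄} (hσ : Fixes σ A) (hτ : Fixes τ A) :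
    Fixes (σ.comp τ) A := fun x hx => by
  rw [Language.Equiv.comp_apply, hτ x hx, hσ x hx]

theorem Fixes.refl (A : Set 𝕄) : Fixes (Language.Equiv.refl L 𝕄) A := fun _ _ => rfl

theorem Fixes.image_eq {σ : 𝕄 ≃[L] 𝕄} (h : Fixes σ A) : σ '' A = A := by
  ext x
  constructor
  · rintro ⟨y, hy, rfl⟩
    rwa [h y hy]
  · exact fun hx => ⟨x, hx, h x hx⟩

theorem symm_comp_comp {σ : 𝕄 ≃[L] 𝕄} (x : α → 𝕄) : σ.symm ∘ (σ ∘ x) = x :=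
  funext fun i => σ.symm_apply_apply (x i)

theorem comp_symm_comp {σ : 𝕄 ≃[L] 𝕄} (x : α → 𝕄) : σ ∘ (σ.symm ∘ x) = x :=
  funext fun i => σ.apply_symm_apply (x i)

/-- Only finitely many constants occur in a formula. Turning them into variables gives the shape
`φ(x, b)` in which Kim-dividing is stated. -/
theorem definable_iff_exists_formula_fin {D : Set (α → 𝕄)} :
    A.Definable L D ↔ ∃ (n : ℕ) (φ : L.Formula (α ⊕ Fin n)) (b : Fin n → 𝕄),
      (∀ i, b i ∈ A) ∧ D = {x | φ.Realize (Sum.elim x b)} := by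
  classical
  rw [definable_iff_exists_formula_sum]
  constructor
  · rintro ⟨φ, rfl⟩
    let s := φ.freeVarFinset.toLeft
    let e := s.equivFin
    refine ⟨s.card, φ.restrictFreeVar fun x => Sum.casesOn (motive := fun y => y ∈ φ.freeVarFinset →
      α ⊕ Fin s.card) x.1 (fun y hy => Sum.inr (e ⟨y, by simpa [s] using hy⟩))
      (fun y _ => Sum.inl y) x.2, fun i => ((e.symm i : A) : 𝕄), fun i => (e.symm i : A).2, ?_⟩
    ext x
    simp only [Formula.Realize, mem_ofPred_eq]
    refine iff_comm.1 (BoundedFormula.realize_restrictFreeVar _ ?_)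
    rintro ⟨y | y, hy⟩ <;> simp
  · rintro ⟨n, φ, b, hb, rfl⟩
    refine ⟨φ.relabel (Sum.elim Sum.inr fun i => Sum.inl ⟨b i, hb i⟩), ?_⟩
    ext x
    simp only [Formula.realize_relabel, mem_ofPred_eq]
    refine iff_of_eq (congrArg _ ?_)
    ext (i | i) <;> rfl

theorem definable_formula_fin {n : ℕ} (φ : L.Formula (α ⊕ Fin n)) {b : Fin n → 𝕄}
    (hb : ∀ i, b i ∈ A) : A.Definable L {x : α → 𝕄 | φ.Realize (Sum.elim x b)} :=
  definable_iff_exists_formula_fin.2 ⟨n, φ, b, hb, rfl⟩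

theorem Definable.exists_fin {D : Set (α → 𝕄)} (hD : A.Definable L D) :
    ∃ (n : ℕ) (v : Fin n → α) (E : Set (Fin n → 𝕄)), Function.Injective v ∧
      A.Definable L E ∧ D = {x | x ∘ v ∈ E} := by
  classical
  obtain ⟨φ, rfl⟩ := hD
  let s := φ.freeVarFinset
  let e := s.equivFin
  refine ⟨s.card, fun i => e.symm i, _, fun i j h => e.symm.injective (Subtype.ext h),
    ⟨φ.restrictFreeVar e, rfl⟩, ?_⟩
  ext x
  simp only [Formula.Realize, mem_ofPred_eq]
  exact iff_comm.1 (BoundedFormula.realize_restrictFreeVar x (by simp))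

/-- The map `w` permutes or identifies variables and plugs in parameters in a single operation. -/
theorem Definable.subst {D : Set (γ → 𝕄)} (hD : A.Definable L D) (w : γ → α ⊕ β) (c : β → 𝕄)
    (hc : ∀ i, c i ∈ A) : A.Definable L {x : α → 𝕄 | Sum.elim x c ∘ w ∈ D} := by
  rw [definable_iff_exists_formula_sum] at hD ⊢
  obtain ⟨φ, rfl⟩ := hD
  refine ⟨φ.relabel (Sum.elim Sum.inl fun k =>
    Sum.elim Sum.inr (fun i => Sum.inl ⟨c i, hc i⟩) (w k)), ?_⟩
  ext x
  simp only [Formula.realize_relabel, mem_ofPred_eq]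
  refine iff_of_eq (congrArg _ ?_)
  ext (i | i)
  · rfl
  · simp only [Function.comp_apply, Sum.elim_inr]
    rcases w i with j | j <;> rfl

theorem Definable.image_equiv {D : Set (α → 𝕄)} (hD : A.Definable L D) (σ : 𝕄 ≃[L] 𝕄) :
    (σ '' A).Definable L {x : α → 𝕄 | σ.symm ∘ x ∈ D} := by
  obtain ⟨n, φ, b, hb, rfl⟩ := definable_iff_exists_formula_fin.1 hD
  refine definable_iff_exists_formula_fin.2 ⟨n, φ, σ ∘ b, fun i => ⟨_, hb i, rfl⟩, ?_⟩
  ext x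
  simp only [mem_ofPred_eq]
  rw [← StrongHomClass.realize_formula σ φ, Sum.comp_elim, comp_symm_comp]

theorem Definable.comp_mem_iff {D : Set (α → 𝕄)} (hD : A.Definable L D) {σ : 𝕄 ≃[L] 𝕄}
    (hσ : Fixes σ A) (x : α → 𝕄) : σ ∘ x ∈ D ↔ x ∈ D := by
  obtain ⟨n, φ, b, hb, rfl⟩ := definable_iff_exists_formula_fin.1 hD
  have hσb : σ ∘ b = b := funext fun i => hσ _ (hb i)
  simp only [mem_ofPred_eq]
  rw [← StrongHomClass.realize_formula σ φ (v := Sum.elim x b), Sum.comp_elim, hσb]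

theorem sameType_iff {a a' : α → 𝕄} :
    SameType L A a a' ↔ ∀ D : Set (α → 𝕄), A.Definable L D → (a ∈ D ↔ a' ∈ D) := by
  constructor
  · rintro h D ⟨φ, rfl⟩
    exact h φ
  · exact fun h φ => h _ ⟨φ, rfl⟩

theorem sameType_of_imp {a a' : α → 𝕄}
    (h : ∀ D : Set (α → 𝕄), A.Definable L D → a ∈ D → a' ∈ D) : SameType L A a a' := by
  refine sameType_iff.2 fun D hD => ⟨h D hD, fun ha' => ?_⟩
  by_contra ha
  exact h _ hD.compl ha ha'

theorem SameType.symm {a a' : α → 𝕄} (h : SameType L A a a') : SameType L A a' a :=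
  fun φ => (h φ).symm

theorem SameType.trans {a a' a'' : α → 𝕄} (h : SameType L A a a') (h' : SameType L A a' a'') :
    SameType L A a a'' := fun φ => (h φ).trans (h' φ)

theorem SameType.comp {a a' : α → 𝕄} (h : SameType L A a a') (g : β → α) :
    SameType L A (a ∘ g) (a' ∘ g) :=
  sameType_iff.2 fun _ hD => sameType_iff.1 h _ (hD.preimage_comp g)

theorem SameType.mono {a a' : α → 𝕄} (h : SameType L B a a') (hAB : A ⊆ B) :
    SameType L A a a' := sameType_iff.2 fun D hD => sameType_iff.1 h D (hD.mono hAB)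

theorem Fixes.sameType {σ : 𝕄 ≃[L] 𝕄} (hσ : Fixes σ A) (a : α → 𝕄) : SameType L A a (σ ∘ a) :=
  sameType_iff.2 fun _ hD => (Definable.comp_mem_iff hD hσ a).symm

theorem SameType.image {a a' : α → 𝕄} (h : SameType L A a a') (σ : 𝕄 ≃[L] 𝕄) :
    SameType L (σ '' A) (σ ∘ a) (σ ∘ a') := by
  refine sameType_iff.2 fun D hD => ?_
  have hA : σ.symm '' (σ '' A) = A := by
    rw [← image_comp]
    convert! image_id A
    ext x
    simp
  have := Definable.image_equiv hD σ.symm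
  rw [hA] at this
  simpa using sameType_iff.1 h _ this

/-- A point of the elementary submodel `M` exists in every nonempty `M`-definable set of tuples,
also when the tuples are infinite. -/
theorem exists_mem_of_definable (hM : ∃ S : L.ElementarySubstructure 𝕄, (S : Set 𝕄) = M)
    {D : Set (α → 𝕄)} (hD : M.Definable L D) (hne : D.Nonempty) [Nonempty 𝕄] :
    ∃ x ∈ D, ∀ i, x i ∈ M := by
  classical
  obtain ⟨S, rfl⟩ := hM
  obtain ⟨n, v, E, hv, hE, rfl⟩ := Definable.exists_fin hD
  obtain ⟨m, φ, b, hb, rfl⟩ := definable_iff_exists_formula_fin.1 hE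
  obtain ⟨x, hx⟩ := hne
  let ψ : L.Formula (Fin m) := (φ.relabel Sum.swap).iExs (Fin n)
  let b' : Fin m → S := fun i => ⟨b i, hb i⟩
  have hψ : ψ.Realize b := by
    rw [Formula.realize_iExs]
    refine ⟨x ∘ v, ?_⟩
    have h : Sum.elim b (x ∘ v) ∘ Sum.swap = Sum.elim (x ∘ v) b := by
      ext (i | i) <;> rfl
    rw [Formula.realize_relabel, h]
    exact hx
  have hψS : ψ.Realize b' := (S.subtype.map_formula ψ b').1 hψ
  rw [Formula.realize_iExs] at hψS
  obtain ⟨y, hy⟩ := hψS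
  obtain ⟨s0⟩ : Nonempty S := inferInstance
  -- Coordinates outside the range of `v` do not matter for membership and receive an arbitrary
  -- point of `S`.
  refine ⟨fun i => if h : ∃ k, v k = i then y h.choose else s0, ?_, fun i => ?_⟩
  · rw [Formula.realize_relabel, ← S.subtype.map_formula] at hy
    refine (iff_of_eq (congrArg φ.Realize ?_)).1 hy
    ext (i | i)
    · have h : ∃ k, v k = v i := ⟨i, rfl⟩
      simp only [Sum.elim_inl, Function.comp_apply, dif_pos h, hv h.choose_spec]
      rfl
    · rfl
  · dsimp only
    split_ifs
    · exact (y _).2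
    · exact s0.2

end DefinableSets

/-! ### Consequences of saturation and homogeneity -/

section Monster

variable (L : FirstOrder.Language.{u, v}) {𝕄 : Type w} [L.Structure 𝕄]

/-- The tuple `a` realizes over `A` the average type of the ultrafilter `𝒰`. -/
def Generic {α : Type*} (𝒰 : Ultrafilter (α → 𝕄)) (A : Set 𝕄) (a : α → 𝕄) : Prop :=
  ∀ D : Set (α → 𝕄), A.Definable L D → D ∈ 𝒰 → a ∈ D

/-- The monster model hypotheses. -/
structure IsMonster (𝕄 : Type w) [L.Structure 𝕄] (κ : Cardinal.{w}) : Prop where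
  nonempty : Nonempty 𝕄
  aleph0_lt : Cardinal.aleph0 < κ
  saturated : IsSaturated L 𝕄 κ
  homogeneous : IsStronglyHomogeneous L 𝕄 κ

variable {L} {α β γ : Type*} {A B M : Set 𝕄} {κ : Cardinal.{w}}

theorem Generic.mono {𝒰 : Ultrafilter (α → 𝕄)} {a : α → 𝕄} (h : Generic L 𝒰 B a) (hAB : A ⊆ B) :
    Generic L 𝒰 A a := fun D hD => h D (hD.mono hAB)

theorem Generic.mem_iff {𝒰 : Ultrafilter (α → 𝕄)} {a : α → 𝕄} (h : Generic L 𝒰 A a)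
    {D : Set (α → 𝕄)} (hD : A.Definable L D) : a ∈ D ↔ D ∈ 𝒰 := by
  refine ⟨fun ha => ?_, h D hD⟩
  by_contra hn
  exact h _ hD.compl (Ultrafilter.compl_mem_iff_notMem.2 hn) ha

theorem Generic.sameType {𝒰 : Ultrafilter (α → 𝕄)} {a a' : α → 𝕄} (h : Generic L 𝒰 A a)
    (h' : Generic L 𝒰 A a') : SameType L A a a' :=
  sameType_iff.2 fun _ hD => (h.mem_iff hD).trans (h'.mem_iff hD).symm

theorem Generic.congr {𝒰 : Ultrafilter (α → 𝕄)} {a a' : α → 𝕄} (h : Generic L 𝒰 A a)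
    (h' : SameType L A a a') : Generic L 𝒰 A a' :=
  fun D hD hU => (sameType_iff.1 h' D hD).1 (h D hD hU)

theorem Generic.comp {𝒰 : Ultrafilter (α → 𝕄)} {a : α → 𝕄} (h : Generic L 𝒰 A a) (e : β → α) :
    Generic L (𝒰.map fun x => x ∘ e) A (a ∘ e) :=
  fun _ hD hU => h _ (hD.preimage_comp e) hU

/-- A saturated structure realizes types in fewer than `κ` variables. -/
theorem exists_generic (hm : IsMonster L 𝕄 κ) {α : Type*}
    (hα : Cardinal.lift.{w} (Cardinal.mk α) < Cardinal.lift κ)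
    (hA : Cardinal.mk A < κ) (𝒰 : Ultrafilter (α → 𝕄)) : ∃ a, Generic L 𝒰 A a := by
  classical
  -- `G` is a set of pairs (coordinate, value), and `P G` says that the values satisfy every
  -- `𝒰`-large definable condition on these coordinates. A maximal such `G` yields the realization.
  let P : Set (α × 𝕄) → Prop := fun G => ∀ E : Set (G → 𝕄), A.Definable L E →
    {x : α → 𝕄 | (fun g : G => x g.1.1) ∈ E} ∈ 𝒰 → (fun g : G => g.1.2) ∈ E
  have hP0 : ∀ c ⊆ {G | P G}, IsChain (· ⊆ ·) c → ∃ ub ∈ {G | P G}, ∀ s ∈ c, s ⊆ ub := by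
    intro c hc hchain
    refine ⟨⋃₀ c, ?_, fun s hs => subset_sUnion_of_mem hs⟩
    intro E hE hU
    obtain ⟨n, v, E', hv, hE', rfl⟩ := Definable.exists_fin hE
    -- A condition on no coordinates is treated apart because the chain may be empty.
    rcases Nat.eq_zero_or_pos n with rfl | hn
    · obtain ⟨x, hx⟩ := 𝒰.nonempty_of_mem hU
      simp only [mem_ofPred_eq] at hx ⊢
      convert! hx
    · obtain ⟨t, ht, hvt⟩ : ∃ t ∈ c, range (fun i => (v i).1) ⊆ t := by
        refine DirectedOn.exists_mem_subset_of_finite_of_subset_sUnion ?_ ?_ (finite_range _) ?_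
        · obtain ⟨t, ht, -⟩ := (v ⟨0, hn⟩).2
          exact ⟨t, ht⟩
        · exact hchain.directedOn
        · rintro _ ⟨i, rfl⟩
          exact (v i).2
      exact hc ht {x | (x ∘ fun i => ⟨(v i).1, hvt ⟨i, rfl⟩⟩) ∈ E'} (hE'.preimage_comp _) hU
  obtain ⟨G, hG⟩ := zorn_subset {G | P G} hP0
  have hGP : P G := hG.prop
  -- Equality of a coordinate with itself is a `𝒰`-large condition, so `G` is single-valued. Its
  -- values therefore form a small parameter set.
  have hfun : ∀ g g' : G, g.1.1 = g'.1.1 → g.1.2 = g'.1.2 := by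
    intro g g' h
    refine hGP {z | z g = z g'} ?_ ?_
    · refine ⟨(Term.var g).equal (Term.var g'), ?_⟩
      ext x
      simp
    · refine Filter.univ_mem' fun x => ?_
      simp [h]
  have hsmall : Cardinal.mk (A ∪ Prod.snd '' G : Set 𝕄) < κ := by
    refine (Cardinal.mk_union_le _ _).trans_lt (Cardinal.add_lt_of_lt hm.aleph0_lt.le hA ?_)
    rw [← Cardinal.lift_lt]
    refine lt_of_le_of_lt ?_ hα
    refine Cardinal.lift_mk_le_lift_mk_of_injective (f := fun y : Prod.snd '' G =>
      (Classical.choose y.2).1) ?_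
    intro y y' h
    have h1 := Classical.choose_spec y.2
    have h2 := Classical.choose_spec y'.2
    have := hfun ⟨_, h1.1⟩ ⟨_, h2.1⟩ h
    exact Subtype.ext (h1.2.symm.trans (this.trans h2.2))
  have htot : ∀ i, ∃ y, (i, y) ∈ G := by
    intro i
    let A' : Set 𝕄 := A ∪ Prod.snd '' G
    -- The type of a value at the coordinate `i` over the values in `G`. Quantifying the new
    -- variable away turns finite satisfiability into an instance of `P G`.
    let p : Set (L[[A']].Formula Unit) := {φ | ∃ E : Set (G ⊕ Unit → 𝕄), A.Definable L E ∧
      {x : α → 𝕄 | Sum.elim (fun g : G => x g.1.1) (fun _ => x i) ∈ E} ∈ 𝒰 ∧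
      ∀ y : Unit → 𝕄, φ.Realize y ↔ Sum.elim (fun g : G => g.1.2) y ∈ E}
    obtain ⟨y, hy⟩ := hm.saturated A' hsmall p (by
      intro s hs
      choose! E hE hEU hEφ using hs
      let E0 : Set (G ⊕ Unit → 𝕄) := ⋂ φ : s, @E φ
      have hE0 : A.Definable L E0 := definable_iInter_of_finite fun φ => hE φ.2
      have hU : {x : α → 𝕄 | Sum.elim (fun g : G => x g.1.1) (fun _ => x i) ∈ E0} ∈ 𝒰 := by
        have : {x : α → 𝕄 | Sum.elim (fun g : G => x g.1.1) (fun _ => x i) ∈ E0} =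
            ⋂ φ : s, {x : α → 𝕄 | Sum.elim (fun g : G => x g.1.1) (fun _ => x i) ∈ @E φ} := by
          ext x
          simp [E0]
        rw [this]
        exact Filter.iInter_mem.2 fun φ => hEU φ.2
      obtain ⟨y, hy⟩ := hGP _ hE0.exists_of_finite (Filter.mem_of_superset hU fun x hx => ⟨_, hx⟩)
      exact ⟨y, fun φ hφ => (hEφ hφ y).2 (mem_iInter.1 hy ⟨φ, hφ⟩)⟩)
    refine ⟨y (), ?_⟩
    have hins : P (insert (i, y ()) G) := by
      intro E hE hU
      let w : (insert (i, y ()) G : Set (α × 𝕄)) → G ⊕ Unit := fun g =>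
        if h : g.1 ∈ G then Sum.inl ⟨g.1, h⟩ else Sum.inr ()
      have hw : ∀ g : (insert (i, y ()) G : Set (α × 𝕄)), ¬ g.1 ∈ G → g.1 = (i, y ()) := fun g hg => g.2.resolve_right hg
      have hE1 := hE.preimage_comp w
      obtain ⟨φ, hφ⟩ := Definable.subst (hE1.mono (subset_union_left : A ⊆ A'))
        (fun k : G ⊕ Unit => k.swap) (fun g : G => g.1.2)
        (fun g => Or.inr ⟨g.1, g.2, rfl⟩)
      have hswap : ∀ z : Unit → 𝕄, Sum.elim z (fun g : G => g.1.2) ∘ (fun k : G ⊕ Unit => k.swap) =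
          Sum.elim (fun g : G => g.1.2) z := by
        intro z
        ext (g | g) <;> rfl
      have hφp : φ ∈ p := by
        refine ⟨_, hE1, ?_, fun z => ?_⟩
        · convert! hU using 1
          ext x
          simp only [mem_ofPred_eq, mem_preimage]
          refine iff_of_eq (congrArg (· ∈ E) (funext fun g => ?_))
          by_cases h : g.1 ∈ G
          · simp [w, h]
          · simp only [Function.comp_apply, w, dif_neg h, Sum.elim_inr]
            rw [hw g h]
        · change z ∈ Set.ofPred φ.Realize ↔ _
          rw [← hφ, mem_ofPred_eq, hswap]
      have := hy φ hφp
      have h2 : y ∈ Set.ofPred φ.Realize := this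
      rw [← hφ, mem_ofPred_eq, hswap, mem_preimage] at h2
      convert! h2 using 1
      funext g
      by_cases h : g.1 ∈ G
      · simp [w, h]
      · simp only [Function.comp_apply, w, dif_neg h, Sum.elim_inr]
        rw [hw g h]
    exact hG.le_of_ge hins (subset_insert _ _) (mem_insert _ _)
  choose a ha using htot
  exact ⟨a, fun D hD hU => hGP {z | (fun i => z ⟨(i, a i), ha i⟩) ∈ D} (hD.preimage_comp _) hU⟩

/-- In a strongly homogeneous structure, tuples with the same type over a small set are conjugate
over this set. -/
theorem exists_equiv_of_sameType (hm : IsMonster L 𝕄 κ) (hA : Cardinal.mk A < κ) {a a' : α → 𝕄}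
    (ha : Cardinal.mk (range a) < κ) (h : SameType L A a a') :
    ∃ σ : 𝕄 ≃[L] 𝕄, Fixes σ A ∧ σ ∘ a = a' := by
  classical
  let c : A ⊕ α → 𝕄 := Sum.elim Subtype.val a
  let c' : A ⊕ α → 𝕄 := Sum.elim Subtype.val a'
  have hcc : ∀ φ : L.Formula (A ⊕ α), φ.Realize c ↔ φ.Realize c' := fun φ =>
    sameType_iff.1 h _ (definable_iff_exists_formula_sum.2 ⟨φ, rfl⟩)
  let f : range c → 𝕄 := fun x => c' x.2.choose
  -- Equality is a formula, so equal entries of `c` correspond to equal entries of `c'` and the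
  -- choice made in `f` is harmless.
  have hf : ∀ k, f ⟨c k, k, rfl⟩ = c' k := by
    intro k
    have hk : ∃ k', c k' = c k := ⟨k, rfl⟩
    have := hcc ((Term.var hk.choose).equal (Term.var k))
    simp only [Formula.realize_equal, Term.realize_var] at this
    exact this.1 hk.choose_spec
  have hsmall : Cardinal.mk (range c) < κ := by
    have hr : range c = A ∪ range a := by simp [c, Sum.elim_range]
    rw [hr]
    exact (Cardinal.mk_union_le _ _).trans_lt (Cardinal.add_lt_of_lt hm.aleph0_lt.le hA ha)
  obtain ⟨σ, hσ⟩ := hm.homogeneous (range c) f hsmall (by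
    intro φ
    have := hcc (φ.relabel fun x => x.2.choose)
    rw [Formula.realize_relabel, Formula.realize_relabel] at this
    convert! this using 2
    funext x
    exact x.2.choose_spec.symm)
  have hσ' : ∀ k, σ (c k) = c' k := fun k => (hσ ⟨c k, k, rfl⟩).trans (hf k)
  exact ⟨σ, fun x hx => hσ' (Sum.inl ⟨x, hx⟩), funext fun i => hσ' (Sum.inr i)⟩

theorem mk_union_lt (hm : IsMonster L 𝕄 κ) (hA : Cardinal.mk A < κ) (hB : Cardinal.mk B < κ) :
    Cardinal.mk (A ∪ B : Set 𝕄) < κ :=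
  (Cardinal.mk_union_le _ _).trans_lt (Cardinal.add_lt_of_lt hm.aleph0_lt.le hA hB)

theorem mk_range_lt {a : α → 𝕄} (hα : Cardinal.lift.{w} (Cardinal.mk α) < Cardinal.lift κ) :
    Cardinal.mk (range a) < κ := by
  rw [← Cardinal.lift_lt]
  exact Cardinal.mk_range_le_lift.trans_lt hα

theorem lift_mk_lt_of_countable (hm : IsMonster L 𝕄 κ) [Countable α] :
    Cardinal.lift.{w} (Cardinal.mk α) < Cardinal.lift κ :=
  (Cardinal.lift_le_aleph0.2 Cardinal.mk_le_aleph0).trans_lt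
    (Cardinal.aleph0_lt_lift.2 hm.aleph0_lt)

theorem mk_countable_lt (hm : IsMonster L 𝕄 κ) (hA : A.Countable) : Cardinal.mk A < κ :=
  (Cardinal.mk_le_aleph0_iff.2 hA.to_subtype).trans_lt hm.aleph0_lt

theorem mk_image_lt (f : 𝕄 → 𝕄) (hA : Cardinal.mk A < κ) : Cardinal.mk (f '' A) < κ :=
  Cardinal.mk_image_le.trans_lt hA

theorem mk_subset_lt (hAB : A ⊆ B) (hB : Cardinal.mk B < κ) : Cardinal.mk A < κ :=
  (Cardinal.mk_le_mk_of_subset hAB).trans_lt hB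

theorem mk_iUnion_range_lt (hm : IsMonster L 𝕄 κ) {ι : Type*}
    (hι : Cardinal.lift.{w} (Cardinal.mk ι) < Cardinal.lift κ) (b : ℕ → ι → 𝕄) :
    Cardinal.mk (⋃ i, range (b i) : Set 𝕄) < κ := by
  have h : (⋃ i, range (b i) : Set 𝕄) = range (fun k : ℕ × ι => b k.1 k.2) := by
    ext x
    simp
  rw [h]
  refine mk_range_lt ?_
  rw [Cardinal.mk_prod, Cardinal.lift_mul, Cardinal.lift_lift, Cardinal.lift_lift]
  refine Cardinal.mul_lt_of_lt ?_ ?_ ?_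
  · exact (Cardinal.aleph0_lt_lift.2 hm.aleph0_lt).le
  · simpa using hm.aleph0_lt
  · simpa using hι

end Monster

/-! ### Coheirs as ultrafilters -/

section Coheirs

variable (L : FirstOrder.Language.{u, v}) {𝕄 : Type w} [L.Structure 𝕄]

/-- The ultrafilter `𝒰` concentrates on tuples of `M`, so its average type is finitely satisfiable
in `M`. -/
def IsCoheir {α : Type*} (M : Set 𝕄) (𝒰 : Ultrafilter (α → 𝕄)) : Prop := {x | ∀ i, x i ∈ M} ∈ 𝒰

/-- The type of `c` over `A` is finitely satisfiable in `M`. -/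
def FinSat {α : Type*} (M A : Set 𝕄) (c : α → 𝕄) : Prop :=
  ∀ D : Set (α → 𝕄), A.Definable L D → c ∈ D → ∃ x ∈ D, ∀ i, x i ∈ M

/-- The filter generated by the `A`-definable sets containing `c`. -/
def typeFilter {α : Type*} (A : Set 𝕄) (c : α → 𝕄) : Filter (α → 𝕄) where
  sets := {W | ∃ D : Set (α → 𝕄), A.Definable L D ∧ c ∈ D ∧ D ⊆ W}
  univ_sets := ⟨univ, definable_univ, mem_univ c, subset_univ _⟩
  sets_of_superset := fun ⟨D, hD, hc, hDW⟩ h => ⟨D, hD, hc, hDW.trans h⟩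
  inter_sets := fun ⟨D, hD, hc, hDW⟩ ⟨D', hD', hc', hDW'⟩ =>
    ⟨D ∩ D', hD.inter hD', ⟨hc, hc'⟩, inter_subset_inter hDW hDW'⟩

/-- The parameters over which the `i`-th term of a Morley sequence over `M` is generic. -/
def prior {ι : Type*} (M : Set 𝕄) (b : ℕ → ι → 𝕄) (i : ℕ) : Set 𝕄 :=
  M ∪ ⋃ j, ⋃ _ : j < i, range (b j)

variable {L} {α β γ ι : Type*} {A B M : Set 𝕄} {κ : Cardinal.{w}}

theorem Definable.mem_typeFilter {c : α → 𝕄} {D : Set (α → 𝕄)} (hD : A.Definable L D)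
    (hc : c ∈ D) : D ∈ typeFilter L A c := ⟨D, hD, hc, Subset.rfl⟩

theorem generic_iff_le {𝒰 : Ultrafilter (α → 𝕄)} {c : α → 𝕄} :
    Generic L 𝒰 A c ↔ (𝒰 : Filter (α → 𝕄)) ≤ typeFilter L A c := by
  constructor
  · rintro h W ⟨D, hD, hc, hDW⟩
    exact Filter.mem_of_superset ((h.mem_iff hD).1 hc) hDW
  · intro h D hD hU
    by_contra hc
    exact Ultrafilter.compl_mem_iff_notMem.1 (h (Definable.mem_typeFilter hD.compl hc)) hU

/-- Finite satisfiability says that the type filter is compatible with the set of tuples from `M`;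
any ultrafilter refining both works. -/
theorem FinSat.exists_generic {c : α → 𝕄} (h : FinSat L M A c) :
    ∃ 𝒰 : Ultrafilter (α → 𝕄), IsCoheir M 𝒰 ∧ Generic L 𝒰 A c := by
  have : (typeFilter L A c ⊓ Filter.principal {x | ∀ i, x i ∈ M}).NeBot := by
    rw [Filter.inf_principal_neBot_iff]
    rintro W ⟨D, hD, hc, hDW⟩
    obtain ⟨x, hx, hxM⟩ := h D hD hc
    exact ⟨x, hDW hx, hxM⟩
  obtain ⟨𝒰, h𝒰⟩ := Ultrafilter.exists_le (typeFilter L A c ⊓ Filter.principal {x | ∀ i, x i ∈ M})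
  exact ⟨𝒰, Filter.le_principal_iff.1 (h𝒰.trans inf_le_right),
    generic_iff_le.2 (h𝒰.trans inf_le_left)⟩

theorem Generic.finSat {𝒰 : Ultrafilter (α → 𝕄)} {c : α → 𝕄} (h : Generic L 𝒰 A c)
    (h𝒰 : IsCoheir M 𝒰) : FinSat L M A c := fun _ hD hc =>
  (𝒰.nonempty_of_mem (Filter.inter_mem ((h.mem_iff hD).1 hc) h𝒰)).imp fun _ hx => hx

theorem FinSat.mono {c : α → 𝕄} (h : FinSat L M B c) (hAB : A ⊆ B) : FinSat L M A c :=
  fun D hD => h D (hD.mono hAB)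

theorem FinSat.comp {c : α → 𝕄} (h : FinSat L M A c) (e : β → α) : FinSat L M A (c ∘ e) := by
  intro D hD hc
  obtain ⟨x, hx, hxM⟩ := h _ (hD.preimage_comp e) hc
  exact ⟨x ∘ e, hx, fun i => hxM _⟩

theorem image_symm_image (σ : 𝕄 ≃[L] 𝕄) (A : Set 𝕄) : σ.symm '' (σ '' A) = A := by
  rw [← image_comp]
  convert! image_id A
  ext x
  simp

/-- The preimage of a definable set under an automorphism. -/
theorem Definable.preimage_equiv {σ : 𝕄 ≃[L] 𝕄} {D : Set (α → 𝕄)}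
    (hD : (σ '' A).Definable L D) : A.Definable L {x : α → 𝕄 | σ ∘ x ∈ D} := by
  have := Definable.image_equiv hD σ.symm
  rwa [image_symm_image] at this

theorem FinSat.image {c : α → 𝕄} (h : FinSat L M A c) (σ : 𝕄 ≃[L] 𝕄) :
    FinSat L (σ '' M) (σ '' A) (σ ∘ c) := by
  intro D hD hc
  obtain ⟨x, hx, hxM⟩ := h _ (Definable.preimage_equiv hD) hc
  exact ⟨σ ∘ x, hx, fun i => ⟨_, hxM i, rfl⟩⟩

/-- Coheirs compose: replace `e` by a tuple `y` of `M` while `c` is a parameter; then `y` is a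
parameter inside `A`, and `c` can be replaced in turn. -/
theorem FinSat.trans {c : α → 𝕄} {e : β → 𝕄} (hc : FinSat L M A c)
    (he : FinSat L M (A ∪ range c) e) (hMA : M ⊆ A) : FinSat L M A (Sum.elim c e) := by
  intro D hD hce
  have h1 := Definable.subst (hD.mono (subset_union_left : A ⊆ A ∪ range c))
    (fun k : α ⊕ β => k.swap) c (fun i => Or.inr ⟨i, rfl⟩)
  have hswap : ∀ (z : α → 𝕄) (y : β → 𝕄), Sum.elim y z ∘ (fun k : α ⊕ β => k.swap) =
      Sum.elim z y := by
    intro z y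
    ext (g | g) <;> rfl
  obtain ⟨y, hy, hyM⟩ := he _ h1 (by rwa [mem_ofPred_eq, hswap])
  rw [mem_ofPred_eq, hswap] at hy
  obtain ⟨z, hz, hzM⟩ := hc _ (Definable.subst hD id y fun i => hMA (hyM i)) hy
  exact ⟨_, hz, by rintro (i | i); exacts [hzM i, hyM i]⟩

theorem finSat_self [Nonempty 𝕄] (hM : IsSmallModel L κ M) (c : α → 𝕄) : FinSat L M M c :=
  fun _ hD hc => exists_mem_of_definable hM.1 hD ⟨c, hc⟩

theorem IsCoheir.map_equiv {𝒰 : Ultrafilter (α → 𝕄)} (h : IsCoheir M 𝒰) (σ : 𝕄 ≃[L] 𝕄) :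
    IsCoheir (σ '' M) (𝒰.map fun x => σ ∘ x) :=
  Ultrafilter.mem_map.2 (Filter.mem_of_superset (f := (𝒰 : Filter (α → 𝕄))) h
    fun _ hx i => ⟨_, hx i, rfl⟩)

theorem Generic.map_equiv {𝒰 : Ultrafilter (α → 𝕄)} {c : α → 𝕄} (h : Generic L 𝒰 A c)
    (σ : 𝕄 ≃[L] 𝕄) : Generic L (𝒰.map fun x => σ ∘ x) (σ '' A) (σ ∘ c) :=
  fun _ hD hU => h _ (Definable.preimage_equiv hD) hU

/-- Coheirs over `M` are invariant under automorphisms fixing `M`. -/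
theorem IsCoheir.map_eq {𝒰 : Ultrafilter (α → 𝕄)} (h : IsCoheir M 𝒰) {σ : 𝕄 ≃[L] 𝕄}
    (hσ : Fixes σ M) : (𝒰.map fun x => σ ∘ x) = 𝒰 := by
  have key : ∀ D : Set (α → 𝕄), D ∈ 𝒰 → D ∈ 𝒰.map fun x => σ ∘ x := fun D hD => by
    refine Ultrafilter.mem_map.2 (Filter.mem_of_superset (f := (𝒰 : Filter (α → 𝕄)))
      (Filter.inter_mem hD h) ?_)
    rintro x ⟨hx, hxM⟩
    have : σ ∘ x = x := funext fun i => hσ _ (hxM i)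
    rwa [mem_preimage, this]
  exact Ultrafilter.coe_le_coe.1 key

theorem Generic.image {𝒰 : Ultrafilter (α → 𝕄)} {c : α → 𝕄} (h : Generic L 𝒰 A c)
    (h𝒰 : IsCoheir M 𝒰) {σ : 𝕄 ≃[L] 𝕄} (hσ : Fixes σ M) : Generic L 𝒰 (σ '' A) (σ ∘ c) := by
  have := h.map_equiv σ
  rwa [h𝒰.map_eq hσ] at this

/-- A coheir extends to a coheir in more variables, with a prescribed type over `M`. -/
theorem IsCoheir.exists_extension [Nonempty 𝕄] (hM : IsSmallModel L κ M)
    {𝒰 : Ultrafilter (β → 𝕄)} (h𝒰 : IsCoheir M 𝒰) {e : β → α} (he : Function.Injective e)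
    {a : α → 𝕄} (ha : Generic L 𝒰 M (a ∘ e)) :
    ∃ 𝒱 : Ultrafilter (α → 𝕄), IsCoheir M 𝒱 ∧ (𝒱.map fun x => x ∘ e) = 𝒰 ∧ Generic L 𝒱 M a := by
  classical
  let F : Filter (α → 𝕄) := typeFilter L M a ⊓
    (Filter.comap (fun x => x ∘ e) (𝒰 : Filter (β → 𝕄)) ⊓ Filter.principal {x | ∀ i, x i ∈ M})
  have hF : F.NeBot := by
    rw [Filter.inf_neBot_iff]
    rintro W ⟨D, hD, hc, hDW⟩ W' hW'
    obtain ⟨U, hU, hUW⟩ := Filter.mem_inf_principal.1 hW'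
    obtain ⟨n, v, E, hv, hE, rfl⟩ := Definable.exists_fin hD
    let idx : {k : Fin n // ∃ b, e b = v k} → β := fun k => k.2.choose
    have hidx : ∀ k, e (idx k) = v k.1 := fun k => k.2.choose_spec
    -- A coordinate used by `D` may also be a variable of `𝒰`; the equations force both copies to
    -- agree.
    let E' : Set (β ⊕ Fin n → 𝕄) := {z | z ∘ Sum.inr ∈ E} ∩
      ⋂ k : {k : Fin n // ∃ b, e b = v k}, {z | z (Sum.inr k.1) = z (Sum.inl (idx k))}
    have hE' : M.Definable L E' := by
      refine (hE.preimage_comp Sum.inr).inter (definable_iInter_of_finite fun k => ?_)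
      exact ⟨(Term.var (Sum.inr k.1)).equal (Term.var (Sum.inl (idx k))), by ext; simp⟩
    have hmem : {y : β → 𝕄 | ∃ z : Fin n → 𝕄, Sum.elim y z ∈ E'} ∈ 𝒰 := by
      rw [← ha.mem_iff hE'.exists_of_finite]
      refine ⟨a ∘ v, hc, mem_iInter.2 fun k => ?_⟩
      simp [hidx]
    obtain ⟨y, ⟨⟨hy, hyU⟩, hyM⟩⟩ := 𝒰.nonempty_of_mem
      (Filter.inter_mem (Filter.inter_mem hmem hU) h𝒰)
    -- Since `y` lies in `M`, the fibre over it is `M`-definable and has a point in `M`.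
    have hdef := Definable.subst hE' (fun k : β ⊕ Fin n => k.swap) y hyM
    obtain ⟨z, hz, hzM⟩ := exists_mem_of_definable hM.1 hdef (by
      obtain ⟨z, hz⟩ := hy
      refine ⟨z, ?_⟩
      rw [mem_ofPred_eq]
      convert! hz using 1
      ext (i | i) <;> rfl)
    obtain ⟨m, hmM⟩ : M.Nonempty := by
      obtain ⟨x, -, hx⟩ := exists_mem_of_definable (α := Unit) hM.1 definable_univ
        ⟨fun _ => Classical.arbitrary 𝕄, mem_univ _⟩
      exact ⟨_, hx ()⟩
    let x : α → 𝕄 := fun i => if h : ∃ b, e b = i then y h.choose else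
      if h : ∃ k, v k = i then z h.choose else m
    have hxe : ∀ b, x (e b) = y b := by
      intro b
      have h : ∃ b', e b' = e b := ⟨b, rfl⟩
      simp only [x, dif_pos h]
      rw [he h.choose_spec]
    have hxv : ∀ k, x (v k) = z k := by
      intro k
      by_cases h : ∃ b, e b = v k
      · simp only [x, dif_pos h]
        have := mem_iInter.1 hz.2 ⟨k, h⟩
        simpa using this.symm
      · have h' : ∃ k', v k' = v k := ⟨k, rfl⟩
        simp only [x, dif_neg h, dif_pos h']
        rw [hv h'.choose_spec]
    have hxM : ∀ i, x i ∈ M := by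
      intro i
      simp only [x]
      split_ifs
      exacts [hyM _, hzM _, hmM]
    refine ⟨x, hDW ?_, ?_⟩
    · have : x ∘ v = z := funext hxv
      rw [mem_ofPred_eq, this]
      exact hz.1
    · refine hUW ?_ hxM
      have : x ∘ e = y := funext hxe
      rwa [mem_preimage, this]
  obtain ⟨𝒱, h𝒱⟩ := Ultrafilter.exists_le F
  refine ⟨𝒱, Filter.le_principal_iff.1 (h𝒱.trans (inf_le_right.trans inf_le_right)), ?_,
    generic_iff_le.2 (h𝒱.trans inf_le_left)⟩
  refine Ultrafilter.coe_le_coe.1 ?_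
  exact Filter.map_le_iff_le_comap.2 (h𝒱.trans (inf_le_right.trans inf_le_left))

end Coheirs

/-! ### Morley sequences in a coheir -/

section Morley

variable {L : FirstOrder.Language.{u, v}} {𝕄 : Type w} [L.Structure 𝕄]
variable {α β ι : Type*} {A B M : Set 𝕄} {κ : Cardinal.{w}}

theorem subset_prior (b : ℕ → ι → 𝕄) (i : ℕ) : M ⊆ prior M b i := subset_union_left

theorem range_subset_prior {b : ℕ → ι → 𝕄} {i j : ℕ} (h : j < i) : range (b j) ⊆ prior M b i :=
  fun _ hx => Or.inr (mem_iUnion₂.2 ⟨j, h, hx⟩)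

theorem prior_subset {b : ℕ → ι → 𝕄} {i : ℕ} (hM : M ⊆ A) (h : ∀ j < i, range (b j) ⊆ A) :
    prior M b i ⊆ A := union_subset hM (iUnion₂_subset h)

theorem image_prior (σ : 𝕄 ≃[L] 𝕄) (b : ℕ → ι → 𝕄) (i : ℕ) :
    σ '' prior M b i = prior (σ '' M) (fun j => σ ∘ b j) i := by
  simp only [prior, image_union, image_iUnion, range_comp]

theorem prior_congr {b b' : ℕ → ι → 𝕄} {i : ℕ} (h : ∀ j < i, b j = b' j) :
    prior M b i = prior M b' i := by
  have : ∀ j, (⋃ _ : j < i, range (b j)) = ⋃ _ : j < i, range (b' j) := fun j =>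
    iUnion_congr fun hj => by rw [h j hj]
  simp only [prior, this]

theorem prior_succ (b : ℕ → ι → 𝕄) (i : ℕ) :
    prior M b (i + 1) = prior M b i ∪ range (b i) := by
  rw [prior, prior, union_assoc]
  congr 1
  ext x
  simp only [mem_iUnion, mem_union, Nat.lt_succ_iff_lt_or_eq, exists_prop]
  constructor
  · rintro ⟨j, hj | rfl, hx⟩
    exacts [Or.inl ⟨j, hj, hx⟩, Or.inr hx]
  · rintro (⟨j, hj, hx⟩ | hx)
    exacts [⟨j, Or.inl hj, hx⟩, ⟨i, Or.inr rfl, hx⟩]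

theorem mk_prior_lt (hm : IsMonster L 𝕄 κ) (hM : Cardinal.mk M < κ) {b : ℕ → ι → 𝕄} {i : ℕ}
    (hb : ∀ j < i, Cardinal.mk (range (b j)) < κ) : Cardinal.mk (prior M b i) < κ := by
  induction i with
  | zero => simpa [prior] using hM
  | succ i ih =>
    rw [prior_succ]
    exact mk_union_lt hm (ih fun j hj => hb j (hj.trans i.lt_succ_self)) (hb i i.lt_succ_self)

/-- Two Morley sequences in the same coheir are conjugate over `M`. -/
theorem exists_equiv_of_generic (hm : IsMonster L 𝕄 κ) (hM : Cardinal.mk M < κ)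
    {𝒰 : Ultrafilter (ι → 𝕄)} (h𝒰 : IsCoheir M 𝒰) {b b' : ℕ → ι → 𝕄} {n : ℕ}
    (hb : ∀ i < n, Generic L 𝒰 (prior M b i) (b i))
    (hb' : ∀ i < n, Generic L 𝒰 (prior M b' i) (b' i))
    (hs : ∀ i < n, Cardinal.mk (range (b i)) < κ) (hs' : ∀ i < n, Cardinal.mk (range (b' i)) < κ) :
    ∃ σ : 𝕄 ≃[L] 𝕄, Fixes σ M ∧ ∀ i < n, σ ∘ b i = b' i := by
  induction n with
  | zero => exact ⟨Language.Equiv.refl L 𝕄, Fixes.refl M, fun i hi => absurd hi i.not_lt_zero⟩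
  | succ n ih =>
    have hlt : ∀ {i}, i < n → i < n + 1 := fun h => h.trans n.lt_succ_self
    obtain ⟨σ, hσ, hσb⟩ := ih (fun i hi => hb i (hlt hi)) (fun i hi => hb' i (hlt hi))
      (fun i hi => hs i (hlt hi)) (fun i hi => hs' i (hlt hi))
    -- The coheir is invariant over `M`, so `σ ∘ b n` and `b' n` realize it over the same initial
    -- segment of `b'`; a further automorphism fixing that segment matches them.
    have h1 := (hb n n.lt_succ_self).image h𝒰 hσ
    rw [image_prior, hσ.image_eq, prior_congr (b' := b') hσb] at h1
    obtain ⟨τ, hτ, hτb⟩ := exists_equiv_of_sameType hm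
      (mk_prior_lt hm hM fun j hj => hs' j (hlt hj))
      (by rw [range_comp]; exact mk_image_lt _ (hs n n.lt_succ_self))
      (h1.sameType (hb' n n.lt_succ_self))
    refine ⟨τ.comp σ, (hτ.mono (subset_prior _ _)).comp hσ, fun i hi => ?_⟩
    rcases Nat.lt_succ_iff_lt_or_eq.1 hi with hi | rfl
    · funext k
      have h2 : σ (b i k) = b' i k := congrFun (hσb i hi) k
      simp only [Function.comp_apply, Language.Equiv.comp_apply, h2]
      exact hτ _ (range_subset_prior hi ⟨k, rfl⟩)
    · exact hτb

theorem exists_morley (hm : IsMonster L 𝕄 κ) (hM : Cardinal.mk M < κ)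
    (hι : Cardinal.lift.{w} (Cardinal.mk ι) < Cardinal.lift κ) (𝒰 : Ultrafilter (ι → 𝕄)) :
    ∃ b : ℕ → ι → 𝕄, ∀ i, Generic L 𝒰 (prior M b i) (b i) := by
  classical
  have h := fun A : {A : Set 𝕄 // Cardinal.mk A < κ} => exists_generic hm hι A.2 𝒰
  choose f hf using h
  -- The recursion carries only the small parameter set; each term is a chosen function of it.
  let S : ℕ → {A : Set 𝕄 // Cardinal.mk A < κ} := fun n => Nat.rec ⟨M, hM⟩
    (fun _ A => ⟨A.1 ∪ range (f A), mk_union_lt hm A.2 (mk_range_lt hι)⟩) n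
  have hS : ∀ n, (S n).1 = prior M (fun n => f (S n)) n := by
    intro n
    induction n with
    | zero => simp [S, prior]
    | succ n ih =>
      rw [prior_succ, ← ih]
  refine ⟨fun n => f (S n), fun i => ?_⟩
  rw [← hS]
  exact hf (S i)

/-- The tail of a Morley sequence in a coheir is finitely satisfiable over its beginning. -/
theorem exists_finSat_tail {𝒰 : Ultrafilter (ι → 𝕄)} (h𝒰 : IsCoheir M 𝒰)
    (hι : Cardinal.lift.{w} (Cardinal.mk ι) < Cardinal.lift κ) (hm : IsMonster L 𝕄 κ)
    {b : ℕ → ι → 𝕄} (hb : ∀ i, Generic L 𝒰 (prior M b i) (b i)) (s r : ℕ) :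
    ∃ C : Set 𝕄, Cardinal.mk C < κ ∧ (∀ l, r ≤ l → l < r + s → range (b l) ⊆ C) ∧
      FinSat L M (prior M b r) (Subtype.val : C → 𝕄) := by
  induction s generalizing r with
  | zero =>
    refine ⟨∅, mk_countable_lt hm countable_empty, fun l h1 h2 => absurd h1 (by omega), ?_⟩
    exact fun D hD hc => ⟨_, hc, fun x => x.2.elim⟩
  | succ s ih =>
    obtain ⟨C, hCs, hC, hfs⟩ := ih (r + 1)
    refine ⟨range (b r) ∪ C, mk_union_lt hm (mk_range_lt hι) hCs, ?_, ?_⟩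
    · intro l h1 h2
      rcases eq_or_lt_of_le h1 with rfl | h1
      · exact subset_union_left
      · exact (hC l h1 (by omega)).trans subset_union_right
    · rw [prior_succ] at hfs
      have h := ((hb r).finSat h𝒰).trans hfs (subset_prior _ _)
      have hr : ∀ x : (range (b r) ∪ C : Set 𝕄), ∃ k, Sum.elim (b r) (Subtype.val : C → 𝕄) k = x := by
        rintro ⟨x, ⟨i, rfl⟩ | hx⟩
        exacts [⟨Sum.inl i, rfl⟩, ⟨Sum.inr ⟨x, hx⟩, rfl⟩]
      choose g hg using hr
      have h' := h.comp g
      rwa [show Sum.elim (b r) (Subtype.val : C → 𝕄) ∘ g = Subtype.val from funext hg] at h'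

end Morley

/-! ### Brooms: a Ramsey argument for several coheirs -/

section Broom

variable {L : FirstOrder.Language.{u, v}} {𝕄 : Type w} [L.Structure 𝕄]
variable {ι : Type*} {β : ℕ → Type*} {M : Set 𝕄} {κ : Cardinal.{w}}

theorem coe_comp (σ τ : 𝕄 ≃[L] 𝕄) {α : Type*} (x : α → 𝕄) : (σ.comp τ) ∘ x = σ ∘ (τ ∘ x) := rfl

/-- For one of the colours `j < k`, the conjugates of `d` by elements of `T` of this colour contain
a sequence whose `j`-th parts form a Morley sequence of length `N` in the coheir `𝒰 j`. -/
def HasBranch (M : Set 𝕄) (𝒰 : ∀ j, Ultrafilter (β j → 𝕄)) (e : ∀ j, β j → ι) (N k : ℕ)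
    (d : ι → 𝕄) (T : Set (𝕄 ≃[L] 𝕄)) (χ : (𝕄 ≃[L] 𝕄) → ℕ → Prop) : Prop :=
  ∃ j < k, ∃ t : ℕ → (𝕄 ≃[L] 𝕄), (∀ i < N, t i ∈ T ∧ χ (t i) j) ∧
    ∀ i < N, Generic L (𝒰 j) (prior M (fun i => (t i ∘ d) ∘ e j) i) ((t i ∘ d) ∘ e j)

/-- Every colouring of `T` by the colours `j < k` has a branch. -/
structure IsBroom (M : Set 𝕄) (𝒰 : ∀ j, Ultrafilter (β j → 𝕄)) (e : ∀ j, β j → ι) (N k : ℕ)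
    (d : ι → 𝕄) (T : Set (𝕄 ≃[L] 𝕄)) : Prop where
  finite : T.Finite
  fixes : ∀ σ ∈ T, Fixes σ M
  hasBranch : ∀ χ : (𝕄 ≃[L] 𝕄) → ℕ → Prop, (∀ σ ∈ T, ∃ j < k, χ σ j) →
    HasBranch M 𝒰 e N k d T χ

variable {𝒰 : ∀ j, Ultrafilter (β j → 𝕄)} {e : ∀ j, β j → ι} {N k : ℕ} {d : ι → 𝕄}

theorem HasBranch.mono {T T' : Set (𝕄 ≃[L] 𝕄)} {χ : (𝕄 ≃[L] 𝕄) → ℕ → Prop} {k' : ℕ}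
    (h : HasBranch M 𝒰 e N k d T χ) (hT : T ⊆ T') (hk : k ≤ k') :
    HasBranch M 𝒰 e N k' d T' χ := by
  obtain ⟨j, hj, t, ht, hg⟩ := h
  exact ⟨j, hj.trans_le hk, t, fun i hi => ⟨hT (ht i hi).1, (ht i hi).2⟩, hg⟩

/-- Transport of a branch along a map `g` of automorphisms which changes the conjugates of the tuple
by a fixed automorphism `τ`. -/
theorem HasBranch.transport {T T' : Set (𝕄 ≃[L] 𝕄)} {χ : (𝕄 ≃[L] 𝕄) → ℕ → Prop} {d' : ι → 𝕄}
    (h𝒰 : ∀ j, IsCoheir M (𝒰 j)) (g : (𝕄 ≃[L] 𝕄) → (𝕄 ≃[L] 𝕄)) (τ : 𝕄 ≃[L] 𝕄) (hτ : Fixes τ M)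
    (hg : ∀ σ ∈ T, g σ ∈ T' ∧ g σ ∘ d' = τ ∘ (σ ∘ d))
    (h : HasBranch M 𝒰 e N k d T fun σ j => χ (g σ) j) : HasBranch M 𝒰 e N k d' T' χ := by
  obtain ⟨j, hj, t, ht, hgen⟩ := h
  refine ⟨j, hj, fun i => g (t i), fun i hi => ⟨(hg _ (ht i hi).1).1, (ht i hi).2⟩, fun i hi => ?_⟩
  have h1 := (hgen i hi).image (h𝒰 j) hτ
  rw [image_prior, hτ.image_eq] at h1
  have h2 : ∀ i < N, τ ∘ ((t i ∘ d) ∘ e j) = (g (t i) ∘ d') ∘ e j := fun i hi => by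
    rw [(hg _ (ht i hi).1).2]
    rfl
  rw [h2 i hi, prior_congr fun l hl => h2 l (hl.trans hi)] at h1
  exact h1

/-- A broom can be moved so that it fixes a set which is finitely satisfiable in `M` over `d`. -/
theorem IsBroom.exists_fixes [Countable ι] (hm : IsMonster L 𝕄 κ) (hM : Cardinal.mk M < κ)
    (h𝒰 : ∀ j, IsCoheir M (𝒰 j)) {T : Set (𝕄 ≃[L] 𝕄)} (hT : IsBroom M 𝒰 e N k d T) {C : Set 𝕄}
    (hC : Cardinal.mk C < κ) (hfs : FinSat L M (M ∪ range d) (Subtype.val : C → 𝕄)) :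
    ∃ T' : Set (𝕄 ≃[L] 𝕄), IsBroom M 𝒰 e N k d T' ∧ ∀ σ ∈ T', Fixes σ (M ∪ C) := by
  classical
  obtain ⟨𝒱, h𝒱, hgen⟩ := hfs.exists_generic
  let E : Set 𝕄 := M ∪ (range d ∪ ⋃ σ ∈ T, range (σ ∘ d))
  have hE : Cardinal.mk E < κ := mk_union_lt hm hM (mk_countable_lt hm
    ((countable_range _).union (hT.finite.countable.biUnion fun _ _ => countable_range _)))
  have hdsmall : Cardinal.mk (M ∪ range d : Set 𝕄) < κ :=
    mk_union_lt hm hM (mk_countable_lt hm (countable_range _))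
  obtain ⟨c, hc⟩ := exists_generic hm (α := C) (by simpa using hC) hE 𝒱
  have hcs : Cardinal.mk (range c) < κ := mk_range_lt (by simpa using hC)
  have hcd : Generic L 𝒱 (M ∪ range d) c :=
    hc.mono (union_subset_union_right _ subset_union_left)
  obtain ⟨τ, hτ, hτc⟩ := exists_equiv_of_sameType hm hdsmall hcs (hcd.sameType hgen)
  have hτM : Fixes τ M := hτ.mono subset_union_left
  have hτd : τ.symm ∘ d = d := funext fun i => hτ.symm _ (Or.inr ⟨i, rfl⟩)
  have hτc' : τ.symm ∘ (Subtype.val : C → 𝕄) = c := by rw [← hτc, symm_comp_comp]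
  -- `c` is generic over `d` and all its conjugates. By invariance of `𝒱`, `σ ∘ c` and `c` have the
  -- same type over `M` and `σ ∘ d`, so `σ` can be corrected to fix `c` without changing `σ ∘ d`.
  -- Conjugating by `τ` then replaces `c` by `C`.
  have hρ : ∀ σ ∈ T, ∃ ρ : 𝕄 ≃[L] 𝕄, Fixes ρ (M ∪ range (σ ∘ d)) ∧ ρ ∘ (σ ∘ c) = c := by
    intro σ hσ
    have h1 := hcd.image h𝒱 (hT.fixes σ hσ)
    rw [image_union, (hT.fixes σ hσ).image_eq, ← range_comp] at h1
    refine exists_equiv_of_sameType hm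
      (mk_union_lt hm hM (mk_countable_lt hm (countable_range _)))
      (by rw [range_comp]; exact mk_image_lt _ hcs) (h1.sameType (hc.mono ?_))
    refine union_subset_union_right _ (subset_union_of_subset_right ?_ _)
    exact subset_biUnion_of_mem (u := fun σ : 𝕄 ≃[L] 𝕄 => range (σ ∘ d)) hσ
  choose! ρ hρ hρc using hρ
  let g : (𝕄 ≃[L] 𝕄) → (𝕄 ≃[L] 𝕄) := fun σ => τ.comp ((ρ σ).comp (σ.comp τ.symm))
  have hgd : ∀ σ ∈ T, g σ ∘ d = τ ∘ (σ ∘ d) := by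
    intro σ hσ
    simp only [g, coe_comp, hτd]
    congr 1
    exact funext fun i => hρ σ hσ _ (Or.inr ⟨i, rfl⟩)
  have hgM : ∀ σ ∈ T, Fixes (g σ) M := fun σ hσ =>
    hτM.comp (((hρ σ hσ).mono subset_union_left).comp ((hT.fixes σ hσ).comp hτM.symm))
  refine ⟨g '' T, ⟨hT.finite.image g, ?_, fun χ hχ => ?_⟩, ?_⟩
  · rintro _ ⟨σ, hσ, rfl⟩
    exact hgM σ hσ
  · exact HasBranch.transport h𝒰 g τ hτM (fun σ hσ => ⟨mem_image_of_mem g hσ, hgd σ hσ⟩)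
      (hT.hasBranch _ fun σ hσ => hχ _ (mem_image_of_mem g hσ))
  · rintro _ ⟨σ, hσ, rfl⟩ x (hx | hx)
    · exact hgM σ hσ x hx
    · have : g σ ∘ (Subtype.val : C → 𝕄) = Subtype.val := by
        simp only [g, coe_comp, hτc', hρc σ hσ, hτc]
      exact congrFun this ⟨x, hx⟩

/-- Along a Morley sequence `θ l ∘ d` whose members carry brooms for the first `k` colours, the
members can be made to have the colour `k` one after the other. -/
theorem exists_partial_broom [Countable ι] (hm : IsMonster L 𝕄 κ) (hM : Cardinal.mk M < κ)
    (h𝒰 : ∀ j, IsCoheir M (𝒰 j)) {𝒱 : Ultrafilter (ι → 𝕄)} (h𝒱 : IsCoheir M 𝒱)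
    {θ : ℕ → (𝕄 ≃[L] 𝕄)}
    (hgen : ∀ l, Generic L 𝒱 (prior M (fun l => θ l ∘ d) l) (θ l ∘ d))
    (ih : ∀ l, ∃ T : Set (𝕄 ≃[L] 𝕄), IsBroom M 𝒰 e N k (θ l ∘ d) T) (r : ℕ) (hr : r ≤ N) :
    ∃ T : Set (𝕄 ≃[L] 𝕄), T.Finite ∧
      (∀ t ∈ T, Fixes t M ∧ ∀ l, r ≤ l → l < N → Fixes t (range (θ l ∘ d))) ∧
      ∀ χ : (𝕄 ≃[L] 𝕄) → ℕ → Prop, (∀ t ∈ T, ∀ l < r, ∃ j < k + 1, χ (t.comp (θ l)) j) →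
        HasBranch M 𝒰 e N k d (image2 (fun t l => t.comp (θ l)) T (Iio r)) χ ∨
          ∃ t ∈ T, ∀ l < r, χ (t.comp (θ l)) k := by
  classical
  induction r with
  | zero =>
    exact ⟨{Language.Equiv.refl L 𝕄}, finite_singleton _,
      fun t ht => by rw [mem_singleton_iff.1 ht]; exact ⟨Fixes.refl _, fun _ _ _ => Fixes.refl _⟩,
      fun χ _ => Or.inr ⟨_, rfl, fun l hl => absurd hl l.not_lt_zero⟩⟩
  | succ r IH =>
    obtain ⟨T, hTfin, hTfix, hT⟩ := IH (by omega)
    obtain ⟨T0, hT0⟩ := ih r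
    obtain ⟨C, hC, hbC, hfs⟩ := exists_finSat_tail h𝒱 (lift_mk_lt_of_countable hm) hm hgen
      (N - (r + 1)) (r + 1)
    have hfs' : FinSat L M (M ∪ range (θ r ∘ d)) (Subtype.val : C → 𝕄) :=
      hfs.mono (union_subset (subset_prior _ _)
        (range_subset_prior (b := fun l => θ l ∘ d) r.lt_succ_self))
    -- The later terms are finitely satisfiable in `M` over the term `r`, so its broom can be moved
    -- to leave them untouched.
    obtain ⟨T', hT', hT'C⟩ := hT0.exists_fixes hm hM h𝒰 hC hfs'
    refine ⟨image2 (fun t' t => t'.comp t) T' T, hT'.finite.image2 _ hTfin, ?_, ?_⟩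
    · rintro _ ⟨t', ht', t, ht, rfl⟩
      refine ⟨(hT'.fixes t' ht').comp (hTfix t ht).1, fun l hl hlN => ?_⟩
      refine Fixes.comp ((hT'C t' ht').mono (subset_union_of_subset_right ?_ _))
        ((hTfix t ht).2 l (by omega) hlN)
      exact hbC l hl (by omega)
    · intro χ hχ
      have hcomp : ∀ t' t : 𝕄 ≃[L] 𝕄, ∀ l,
          t'.comp (t.comp (θ l)) = (t'.comp t).comp (θ l) := fun _ _ _ => rfl
      by_cases hbr : HasBranch M 𝒰 e N k d
        (image2 (fun t l => t.comp (θ l)) (image2 (fun t' t => t'.comp t) T' T) (Iio (r + 1))) χ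
      · exact Or.inl hbr
      right
      -- Each `t'` pulls the colouring back to `T`. A branch there is carried forward by `t'`, so
      -- the other alternative must hold.
      have h1 : ∀ t' ∈ T', ∃ t ∈ T, ∀ l < r, χ ((t'.comp t).comp (θ l)) k := by
        intro t' ht'
        rcases hT (fun σ j => χ (t'.comp σ) j) (fun t ht l hl =>
          hχ _ ⟨t', ht', t, ht, rfl⟩ l (by omega)) with h | h
        · refine absurd (HasBranch.transport h𝒰 (fun σ => t'.comp σ) t' (hT'.fixes t' ht') ?_ h) hbr
          rintro _ ⟨t, ht, l, hl, rfl⟩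
          exact ⟨⟨_, ⟨t', ht', t, ht, rfl⟩, l, Nat.lt_succ_of_lt hl, hcomp _ _ _⟩, rfl⟩
        · exact h
      choose! g hgT hg using h1
      by_contra hcon
      push Not at hcon
      -- If no composite has colour `k` on all of its first `r + 1` terms, the failure is at the
      -- term `r`, which then has a colour below `k`: this colours the broom `T'`.
      have h2 : ∀ t' ∈ T', ∃ j < k, χ ((t'.comp (g t')).comp (θ r)) j := by
        intro t' ht'
        obtain ⟨j, hj, hχj⟩ := hχ _ ⟨t', ht', g t', hgT t' ht', rfl⟩ r r.lt_succ_self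
        obtain ⟨l, hl, hnl⟩ := hcon _ ⟨t', ht', g t', hgT t' ht', rfl⟩
        rcases Nat.lt_succ_iff_lt_or_eq.1 hl with hl | rfl
        · exact absurd (hg t' ht' l hl) hnl
        · rcases Nat.lt_succ_iff_lt_or_eq.1 hj with hj | rfl
          · exact ⟨j, hj, hχj⟩
          · exact absurd hχj hnl
      refine hbr (HasBranch.transport h𝒰 (fun t' => (t'.comp (g t')).comp (θ r))
        (Language.Equiv.refl L 𝕄) (Fixes.refl M) ?_
        (hT'.hasBranch (fun t' j => χ ((t'.comp (g t')).comp (θ r)) j) h2))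
      intro t' ht'
      refine ⟨⟨_, ⟨t', ht', g t', hgT t' ht', rfl⟩, r, r.lt_succ_self, rfl⟩, ?_⟩
      -- Members of `T` fix the terms from `r` on, so the choice of `g t'` does not affect the
      -- conjugate coloured through `t'`.
      have h3 : g t' ∘ (θ r ∘ d) = θ r ∘ d :=
        funext fun i => (hTfix _ (hgT t' ht')).2 r le_rfl (by omega) _ ⟨i, rfl⟩
      rw [coe_comp, coe_comp, h3]
      rfl

/-- Induction on the number of colours. Extend the coheir of the last colour to one for the whole
tuple `d`, and attach a broom for the other colours to each term of a Morley sequence in it. Either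
a branch of an old colour appears, or `N` successive terms have the last colour and their parts
along `e k` are the branch. -/
theorem exists_broom [Countable ι] [Nonempty 𝕄] (hm : IsMonster L 𝕄 κ) (hM : IsSmallModel L κ M)
    (h𝒰 : ∀ j, IsCoheir M (𝒰 j)) (N k : ℕ) (he : ∀ j < k, Function.Injective (e j)) (d : ι → 𝕄)
    (hd : ∀ j < k, Generic L (𝒰 j) M (d ∘ e j)) : ∃ T, IsBroom (L := L) M 𝒰 e N k d T := by
  classical
  induction k generalizing d with
  | zero =>
    refine ⟨{Language.Equiv.refl L 𝕄}, finite_singleton _, fun σ hσ => ?_, fun χ hχ => ?_⟩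
    · rw [mem_singleton_iff.1 hσ]
      exact Fixes.refl M
    · obtain ⟨j, hj, -⟩ := hχ _ rfl
      exact absurd hj j.not_lt_zero
  | succ k ih =>
    obtain ⟨𝒱, h𝒱, h𝒱𝒰, hd𝒱⟩ := (h𝒰 k).exists_extension hM (he k k.lt_succ_self)
      (hd k k.lt_succ_self)
    obtain ⟨b, hb⟩ := exists_morley hm hM.2 (lift_mk_lt_of_countable hm) 𝒱
    have hθ : ∀ l, ∃ θ : 𝕄 ≃[L] 𝕄, Fixes θ M ∧ θ ∘ d = b l := fun l =>
      exists_equiv_of_sameType hm hM.2 (mk_countable_lt hm (countable_range _))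
        (hd𝒱.sameType ((hb l).mono (subset_prior _ _)))
    choose θ hθ hθb using hθ
    obtain rfl : (fun l => θ l ∘ d) = b := funext hθb
    obtain ⟨T, hTfin, hTfix, hT⟩ := exists_partial_broom hm hM.2 h𝒰 h𝒱 hb (fun l =>
      ih (fun j hj => he j (hj.trans k.lt_succ_self)) (θ l ∘ d) fun j hj =>
        (hd j (hj.trans k.lt_succ_self)).congr ((hθ l).sameType _)) N le_rfl
    refine ⟨image2 (fun t l => t.comp (θ l)) T (Iio N), hTfin.image2 _ (finite_Iio N), ?_, fun χ hχ => ?_⟩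
    · rintro _ ⟨t, ht, l, -, rfl⟩
      exact (hTfix t ht).1.comp (hθ l)
    rcases hT χ fun t ht l hl => hχ _ ⟨t, ht, l, hl, rfl⟩ with h | ⟨t, ht, htk⟩
    · exact h.mono Subset.rfl k.le_succ
    · refine ⟨k, k.lt_succ_self, fun l => t.comp (θ l), fun l hl => ⟨⟨t, ht, l, hl, rfl⟩, htk l hl⟩,
        fun l _ => ?_⟩
      have h1 := ((hb l).comp (e k)).mono (A := prior M (fun l => (θ l ∘ d) ∘ e k) l)
        (prior_subset (subset_prior _ _) fun j hj =>
          (range_comp_subset_range _ _).trans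
            (range_subset_prior (b := fun l => θ l ∘ d) hj))
      rw [h𝒱𝒰] at h1
      have h2 := h1.image (h𝒰 k) (hTfix t ht).1
      rw [image_prior, (hTfix t ht).1.image_eq] at h2
      exact h2

end Broom

/-! ### Global types and coheir Morley sequences -/

section CoheirMorley

variable {L : FirstOrder.Language.{u, v}} {𝕄 : Type w} [L.Structure 𝕄]
variable {α β ι : Type*} {A B M : Set 𝕄} {κ : Cardinal.{w}}

theorem realize_onFormula_constants (φ : L[[A]].Formula ι) (x : ι → 𝕄) :
    ((L.lhomWithConstantsMap (Subtype.val : A → 𝕄)).onFormula φ).Realize x ↔ φ.Realize x := by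
  have h1 : (LHom.constantsOnMap (Subtype.val : A → 𝕄)).IsExpansionOn 𝕄 :=
    constantsOnMap_isExpansionOn rfl
  have h2 : (L.lhomWithConstantsMap (Subtype.val : A → 𝕄)).IsExpansionOn 𝕄 :=
    LHom.sumMap_isExpansionOn _ _ 𝕄
  exact LHom.realize_onFormula _ _

/-- The global average type of an ultrafilter. -/
def averageType [Nonempty 𝕄] (𝒰 : Ultrafilter (ι → 𝕄)) : GlobalType L 𝕄 ι where
  toTheory := {ψ | {x : ι → 𝕄 | (Formula.equivSentence.symm ψ).Realize x} ∈ 𝒰}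
  subset' := by
    rintro _ ⟨φ, hφ, rfl⟩
    refine Filter.univ_mem' fun x => ?_
    rw [mem_ofPred_eq, Formula.realize_equivSentence_symm]
    let := constantsOn.structure x
    exact (LHom.realize_onSentence 𝕄 (L[[𝕄]].lhomWithConstants ι) φ).2 hφ
  isMaximal' := by
    refine ⟨?_, fun φ => ?_⟩
    · rw [Theory.isSatisfiable_iff_isFinitelySatisfiable]
      intro T0 hT0
      have : (⋂ φ ∈ T0, {x : ι → 𝕄 | (Formula.equivSentence.symm φ).Realize x}) ∈ 𝒰 :=
        (Filter.biInter_finset_mem T0).2 fun φ hφ => hT0 hφ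
      obtain ⟨x, hx⟩ := 𝒰.nonempty_of_mem this
      let := constantsOn.structure x
      have hmod : 𝕄 ⊨ (T0 : L[[𝕄]][[ι]].Theory) := by
        refine (Theory.model_iff _).2 fun φ hφ => ?_
        exact (Formula.realize_equivSentence_symm 𝕄 φ x).1 (mem_iInter₂.1 hx φ hφ)
      exact Theory.Model.isSatisfiable 𝕄
    · by_cases h : {x : ι → 𝕄 | (Formula.equivSentence.symm φ).Realize x} ∈ 𝒰
      · exact Or.inl h
      · refine Or.inr ?_
        rw [← Ultrafilter.compl_mem_iff_notMem] at h
        refine Filter.mem_of_superset h fun x hx => ?_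
        obtain ⟨ψ, rfl⟩ := Formula.equivSentence.surjective φ
        rw [← Formula.equivSentence_not]
        simpa using hx

theorem mem_averageType [Nonempty 𝕄] {𝒰 : Ultrafilter (ι → 𝕄)} {φ : L[[𝕄]].Formula ι} :
    Formula.equivSentence φ ∈ averageType (L := L) 𝒰 ↔ {x | φ.Realize x} ∈ 𝒰 := by
  change {x : ι → 𝕄 | (Formula.equivSentence.symm (Formula.equivSentence φ)).Realize x} ∈ 𝒰 ↔ _
  rw [_root_.Equiv.symm_apply_apply]

/-- A global type which is finitely satisfiable in `M` is the average type of an ultrafilter which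
concentrates on `M`. -/
theorem FinitelySatisfiableIn.exists_ultrafilter {p : GlobalType L 𝕄 ι}
    (hp : FinitelySatisfiableIn p M) : ∃ 𝒰 : Ultrafilter (ι → 𝕄), IsCoheir M 𝒰 ∧
      ∀ φ : L[[𝕄]].Formula ι, Formula.equivSentence φ ∈ p ↔ {x | φ.Realize x} ∈ 𝒰 := by
  let F : Filter (ι → 𝕄) :=
    { sets := {W | ∃ φ : L[[𝕄]].Formula ι, Formula.equivSentence φ ∈ p ∧ {x | φ.Realize x} ⊆ W}
      univ_sets := by
        obtain h | h := p.mem_or_not_mem (Formula.equivSentence ⊤)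
        exacts [⟨_, h, subset_univ _⟩, ⟨(⊤ : L[[𝕄]].Formula ι).not, h, subset_univ _⟩]
      sets_of_superset := fun ⟨φ, hφ, h⟩ h' => ⟨φ, hφ, h.trans h'⟩
      inter_sets := by
        rintro W W' ⟨φ, hφ, h⟩ ⟨φ', hφ', h'⟩
        refine ⟨φ ⊓ φ', ?_, fun x hx => ?_⟩
        · rw [Formula.equivSentence_inf]
          refine p.isMaximal.mem_of_models ?_
          intro N v xs
          have h1 := N.is_model.realize_of_mem _ hφ
          have h2 := N.is_model.realize_of_mem _ hφ'
          rw [BoundedFormula.realize_inf]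
          refine ⟨?_, ?_⟩
          · rw [Subsingleton.elim xs default, Subsingleton.elim v default]
            exact h1
          · rw [Subsingleton.elim xs default, Subsingleton.elim v default]
            exact h2
        · rw [mem_ofPred_eq, Formula.realize_inf] at hx
          exact ⟨h hx.1, h' hx.2⟩ }
  have : (F ⊓ Filter.principal {x | ∀ i, x i ∈ M}).NeBot := by
    rw [Filter.inf_principal_neBot_iff]
    rintro W ⟨φ, hφ, h⟩
    obtain ⟨c, hc, hφc⟩ := hp φ hφ
    exact ⟨c, h hφc, hc⟩
  obtain ⟨𝒰, h𝒰⟩ := Ultrafilter.exists_le (F ⊓ Filter.principal {x | ∀ i, x i ∈ M})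
  have hF : ∀ φ : L[[𝕄]].Formula ι, Formula.equivSentence φ ∈ p → {x | φ.Realize x} ∈ 𝒰 :=
    fun φ hφ => h𝒰.trans inf_le_left ⟨φ, hφ, Subset.rfl⟩
  refine ⟨𝒰, Filter.le_principal_iff.1 (h𝒰.trans inf_le_right), fun φ => ⟨hF φ, fun h => ?_⟩⟩
  refine (p.mem_or_not_mem _).resolve_right fun hn => ?_
  rw [← Formula.equivSentence_not] at hn
  obtain ⟨x, hx, hx'⟩ := 𝒰.nonempty_of_mem (Filter.inter_mem h (hF _ hn))
  rw [mem_ofPred_eq, Formula.realize_not] at hx'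
  exact hx' hx

/-- The bridge between the definition by global types and the ultrafilters used throughout. -/
theorem isCoheirMorley_iff [Nonempty 𝕄] {b : ℕ → ι → 𝕄} : IsCoheirMorley L M b ↔
    ∃ 𝒰 : Ultrafilter (ι → 𝕄), IsCoheir M 𝒰 ∧ ∀ i, Generic L 𝒰 (prior M b i) (b i) := by
  constructor
  · rintro ⟨p, hp, hb⟩
    obtain ⟨𝒰, h𝒰, hp𝒰⟩ := hp.exists_ultrafilter
    refine ⟨𝒰, h𝒰, ?_⟩
    rintro i D ⟨φ, rfl⟩ hD
    refine hb i φ ((hp𝒰 _).2 ?_)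
    exact Filter.mem_of_superset hD fun x hx => (realize_onFormula_constants φ x).2 hx
  · rintro ⟨𝒰, h𝒰, hb⟩
    refine ⟨averageType 𝒰, fun φ hφ => ?_, fun i φ hφ => ?_⟩
    · obtain ⟨x, hx, hxM⟩ := 𝒰.nonempty_of_mem (Filter.inter_mem (mem_averageType.1 hφ) h𝒰)
      exact ⟨x, hxM, hx⟩
    · exact hb i _ ⟨φ, rfl⟩ (Filter.mem_of_superset (mem_averageType.1 hφ)
        fun x hx => (realize_onFormula_constants φ x).1 hx)

theorem IsCoheirMorley.image [Nonempty 𝕄] {b : ℕ → ι → 𝕄} (h : IsCoheirMorley L M b)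
    (σ : 𝕄 ≃[L] 𝕄) : IsCoheirMorley L (σ '' M) fun i => σ ∘ b i := by
  obtain ⟨𝒰, h𝒰, hb⟩ := isCoheirMorley_iff.1 h
  refine isCoheirMorley_iff.2 ⟨_, h𝒰.map_equiv σ, fun i => ?_⟩
  rw [← image_prior]
  exact (hb i).map_equiv σ

/-- Tuples extracted from the members of a coheir Morley sequence and from the base form a coheir
Morley sequence. -/
theorem IsCoheirMorley.subst [Nonempty 𝕄] {b : ℕ → ι → 𝕄} (h : IsCoheirMorley L M b)
    (g : α → ι ⊕ M) : IsCoheirMorley L M fun i => Sum.elim (b i) (Subtype.val : M → 𝕄) ∘ g := by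
  obtain ⟨𝒰, h𝒰, hb⟩ := isCoheirMorley_iff.1 h
  refine isCoheirMorley_iff.2 ⟨𝒰.map fun x => Sum.elim x (Subtype.val : M → 𝕄) ∘ g, ?_, ?_⟩
  · refine Ultrafilter.mem_map.2 (Filter.mem_of_superset (f := (𝒰 : Filter (ι → 𝕄))) h𝒰 ?_)
    intro x hx k
    simp only [Function.comp_apply]
    rcases g k with i | m
    exacts [hx i, m.2]
  · intro i D hD hU
    have hsub : prior M (fun i => Sum.elim (b i) (Subtype.val : M → 𝕄) ∘ g) i ⊆ prior M b i := by
      refine prior_subset (subset_prior _ _) fun j hj => ?_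
      rintro _ ⟨k, rfl⟩
      simp only [Function.comp_apply]
      rcases g k with l | m
      exacts [range_subset_prior hj ⟨l, rfl⟩, subset_prior _ _ m.2]
    exact hb i _ (Definable.subst (hD.mono hsub) g _ fun m => subset_prior _ _ m.2) hU

/-- Each finite tuple starts a coheir Morley sequence. -/
theorem exists_isCoheirMorley (hm : IsMonster L 𝕄 κ) (hM : IsSmallModel L κ M) [Countable ι]
    (c : ι → 𝕄) : ∃ b : ℕ → ι → 𝕄, IsCoheirMorley L M b ∧ b 0 = c := by
  have := hm.nonempty
  obtain ⟨𝒰, h𝒰, hc⟩ := (finSat_self hM c).exists_generic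
  obtain ⟨b, hb⟩ := exists_morley hm hM.2 (lift_mk_lt_of_countable hm) 𝒰
  obtain ⟨σ, hσ, hσb⟩ := exists_equiv_of_sameType hm hM.2
    (mk_countable_lt hm (countable_range (b 0))) (((hb 0).mono (subset_prior _ _)).sameType hc)
  refine ⟨fun i => σ ∘ b i, ?_, hσb⟩
  have := (isCoheirMorley_iff.2 ⟨𝒰, h𝒰, hb⟩).image σ
  rwa [hσ.image_eq] at this

theorem IsCoheirMorley.sameType [Nonempty 𝕄] {b : ℕ → ι → 𝕄} (h : IsCoheirMorley L M b)
    (i j : ℕ) : SameType L M (b i) (b j) := by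
  obtain ⟨𝒰, h𝒰, hb⟩ := isCoheirMorley_iff.1 h
  exact ((hb i).mono (subset_prior _ _)).sameType ((hb j).mono (subset_prior _ _))

end CoheirMorley

/-! ### Small models and triples under automorphisms -/

section Triples

variable {L : FirstOrder.Language.{u, v}} {𝕄 : Type w} [L.Structure 𝕄]
variable {α β ι : Type*} {A B C M : Set 𝕄} {κ : Cardinal.{w}}

/-- Tarski–Vaught test: pull a nonempty definable set back by `σ`, find a point in `M`, and push it
forward. -/
theorem IsSmallModel.image [Nonempty 𝕄] (hM : IsSmallModel L κ M) (σ : 𝕄 ≃[L] 𝕄) :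
    IsSmallModel L κ (σ '' M) := by
  have h : L.MeetsDefinable (σ '' M) := by
    rintro D ⟨x, hx⟩ hD
    obtain ⟨y, hy, hyM⟩ := exists_mem_of_definable hM.1
      (Definable.preimage_equiv (show (σ '' M).Definable L {x : Fin 1 → 𝕄 | x 0 ∈ D} from hD))
      ⟨fun _ => σ.symm x, by simpa using hx⟩
    exact ⟨σ (y 0), hy, _, hyM 0, rfl⟩
  exact ⟨⟨h.toElementarySubstructure, h.closure_eq_self⟩, mk_image_lt _ hM.2⟩

theorem IsTriple.image [Nonempty 𝕄] (h : IsTriple L κ M A B) (σ : 𝕄 ≃[L] 𝕄) :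
    IsTriple L κ (σ '' M) (σ '' A) (σ '' B) :=
  ⟨h.model.image σ, image_mono h.left, image_mono h.right, mk_image_lt _ h.left_small,
    mk_image_lt _ h.right_small⟩

theorem Fixes.subset_image {σ : 𝕄 ≃[L] 𝕄} (hσ : Fixes σ M) (h : M ⊆ A) : M ⊆ σ '' A :=
  fun x hx => ⟨x, h hx, hσ x hx⟩

theorem IsTriple.image_left (h : IsTriple L κ M A B) {σ : 𝕄 ≃[L] 𝕄} (hσ : Fixes σ M) :
    IsTriple L κ M (σ '' A) B :=
  ⟨h.model, hσ.subset_image h.left, h.right, mk_image_lt _ h.left_small, h.right_small⟩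

theorem IsTriple.with_right (h : IsTriple L κ M A B) (hM : M ⊆ C) (hC : Cardinal.mk C < κ) :
    IsTriple L κ M A C := ⟨h.model, h.left, hM, h.left_small, hC⟩

theorem IsTriple.subset_right (h : IsTriple L κ M A B) (hM : M ⊆ C) (hC : C ⊆ B) :
    IsTriple L κ M A C := h.with_right hM (mk_subset_lt hC h.right_small)

theorem sameType_val_iff (hm : IsMonster L 𝕄 κ) (hB : Cardinal.mk B < κ) (hA : Cardinal.mk A < κ)
    {f : A → 𝕄} : SameType L B (Subtype.val : A → 𝕄) f ↔
      ∃ σ : 𝕄 ≃[L] 𝕄, Fixes σ B ∧ σ ∘ (Subtype.val : A → 𝕄) = f := by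
  constructor
  · exact fun h => exists_equiv_of_sameType hm hB (by simpa using hA) h
  · rintro ⟨σ, hσ, rfl⟩
    exact hσ.sameType _

theorem range_comp_val (σ : 𝕄 ≃[L] 𝕄) (A : Set 𝕄) :
    range (σ ∘ (Subtype.val : A → 𝕄)) = σ '' A := by
  rw [range_comp, Subtype.range_coe]

end Triples

/-! ### Locality and compactness -/

section Local

variable (L : FirstOrder.Language.{u, v}) {𝕄 : Type w} [L.Structure 𝕄]

/-- The relation `A ⫝_M B` is determined by its restrictions to finitely many parameters of `B`, and
for these it is a closed condition on the type of `A`. -/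
def IsLocal (κ : Cardinal.{w}) (R : Relation 𝕄) : Prop :=
  ∀ M A B : Set 𝕄, IsTriple L κ M A B →
    (∀ F : Set 𝕄, F.Finite → F ⊆ B → ∀ D : Set (A → 𝕄), (M ∪ F).Definable L D →
      (Subtype.val : A → 𝕄) ∈ D → ∃ σ : 𝕄 ≃[L] 𝕄, Fixes σ M ∧
        σ ∘ (Subtype.val : A → 𝕄) ∈ D ∧ R M (σ '' A) (M ∪ F)) → R M A B

variable {L} {M A B : Set 𝕄} {κ : Cardinal.{w}}

theorem Existence.exists_equiv {R : Relation 𝕄} (hm : IsMonster L 𝕄 κ) (h : Existence L κ R)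
    (ht : IsTriple L κ M A B) : ∃ σ : 𝕄 ≃[L] 𝕄, Fixes σ M ∧ R M (σ '' A) B := by
  obtain ⟨f, hf, hR⟩ := h M A B ht
  obtain ⟨σ, hσ, rfl⟩ := (sameType_val_iff hm ht.model.2 ht.left_small).1 hf
  rw [range_comp_val] at hR
  exact ⟨σ, hσ, hR⟩

theorem RightExtension.exists_equiv {R : Relation 𝕄} {C : Set 𝕄} (hm : IsMonster L 𝕄 κ)
    (h : RightExtension L κ R) (ht : IsTriple L κ M A B) (hBC : B ⊆ C) (hC : Cardinal.mk C < κ)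
    (hR : R M A B) : ∃ σ : 𝕄 ≃[L] 𝕄, Fixes σ B ∧ R M (σ '' A) C := by
  obtain ⟨f, hf, hR⟩ := h M A B C ht hBC hC hR
  obtain ⟨σ, hσ, rfl⟩ := (sameType_val_iff hm ht.right_small ht.left_small).1 hf
  rw [range_comp_val] at hR
  exact ⟨σ, hσ, hR⟩

/-- Compactness for a decreasing sequence of local relations. -/
theorem exists_equiv_of_isLocal (hm : IsMonster L 𝕄 κ) {R : ℕ → Relation 𝕄}
    (hloc : ∀ n, IsLocal L κ (R n))
    (hanti : ∀ n m, n ≤ m → ∀ M A B, IsTriple L κ M A B → R m M A B → R n M A B)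
    (hmono : ∀ n, RightMonotonicity L κ (R n)) (ht : IsTriple L κ M A B) (𝒢 : Filter (A → 𝕄))
    (h : ∀ W ∈ 𝒢, ∀ n, ∀ F : Set 𝕄, F.Finite → F ⊆ B → ∃ σ : 𝕄 ≃[L] 𝕄, Fixes σ M ∧
      σ ∘ (Subtype.val : A → 𝕄) ∈ W ∧ R n M (σ '' A) (M ∪ F)) :
    ∃ σ : 𝕄 ≃[L] 𝕄, Fixes σ M ∧ (∀ n, R n M (σ '' A) B) ∧
      ∀ D ∈ 𝒢, B.Definable L D → σ ∘ (Subtype.val : A → 𝕄) ∈ D := by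
  -- Generated by the sets of conjugates of `A` over `M` that lie in `V` and are `R n`-independent
  -- from `F`. Antitonicity in `n` and right monotonicity make it closed under intersection.
  let H : Filter (A → 𝕄) :=
    { sets := {W | ∃ V ∈ 𝒢, ∃ n, ∃ F : Set 𝕄, F.Finite ∧ F ⊆ B ∧ ∀ σ : 𝕄 ≃[L] 𝕄, Fixes σ M →
        σ ∘ (Subtype.val : A → 𝕄) ∈ V → R n M (σ '' A) (M ∪ F) →
          σ ∘ (Subtype.val : A → 𝕄) ∈ W}
      univ_sets := ⟨univ, Filter.univ_mem, 0, ∅, finite_empty, empty_subset _,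
        fun _ _ _ _ => mem_univ _⟩
      sets_of_superset := fun ⟨V, hV, n, F, hF, hFB, hσ⟩ hWW' =>
        ⟨V, hV, n, F, hF, hFB, fun σ h1 h2 h3 => hWW' (hσ σ h1 h2 h3)⟩
      inter_sets := by
        rintro W W' ⟨V, hV, n, F, hF, hFB, hσ⟩ ⟨V', hV', n', F', hF', hFB', hσ'⟩
        refine ⟨V ∩ V', Filter.inter_mem hV hV', max n n', F ∪ F', hF.union hF',
          union_subset hFB hFB', fun σ h1 h2 h3 => ?_⟩
        have ht' : IsTriple L κ M (σ '' A) (M ∪ (F ∪ F')) := (ht.image_left h1).subset_right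
          subset_union_left (union_subset ht.right (union_subset hFB hFB'))
        refine ⟨hσ σ h1 h2.1 ?_, hσ' σ h1 h2.2 ?_⟩
        · exact hmono n M _ _ _ ht' subset_union_left
            (union_subset_union_right _ subset_union_left) (hanti _ _ (le_max_left _ _) _ _ _ ht' h3)
        · exact hmono n' M _ _ _ ht' subset_union_left
            (union_subset_union_right _ subset_union_right)
            (hanti _ _ (le_max_right _ _) _ _ _ ht' h3) }
  have hH : H.NeBot := by
    rw [← Filter.forall_mem_nonempty_iff_neBot]
    rintro W ⟨V, hV, n, F, hF, hFB, hσ⟩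
    obtain ⟨σ, h1, h2, h3⟩ := h V hV n F hF hFB
    exact ⟨_, hσ σ h1 h2 h3⟩
  obtain ⟨𝒰, h𝒰⟩ := Ultrafilter.exists_le H
  obtain ⟨a, ha⟩ := exists_generic hm (α := A) (by simpa using ht.left_small) ht.right_small 𝒰
  have haM : SameType L M (Subtype.val : A → 𝕄) a := by
    refine sameType_of_imp fun D hD hmem => (ha.mem_iff (hD.mono ht.right)).2 (h𝒰 ?_)
    exact ⟨univ, Filter.univ_mem, 0, ∅, finite_empty, empty_subset _,
      fun σ h1 _ _ => (Definable.comp_mem_iff hD h1 _).2 hmem⟩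
  obtain ⟨σ, hσ, rfl⟩ := (sameType_val_iff hm ht.model.2 ht.left_small).1 haM
  refine ⟨σ, hσ, fun n => ?_, fun D hD hDB => (ha.mem_iff hDB).2 (h𝒰 ?_)⟩
  · refine hloc n M _ B (ht.image_left hσ) fun F hF hFB D hD hmem => ?_
    let g : (σ '' A : Set 𝕄) → A := fun y => ⟨σ.symm y, by
      obtain ⟨x, hx, hxy⟩ := y.2
      rw [← hxy, Language.Equiv.symm_apply_apply]
      exact hx⟩
    have hg : ∀ τ : 𝕄 ≃[L] 𝕄, (τ ∘ (Subtype.val : A → 𝕄)) ∘ g =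
        (τ.comp σ.symm) ∘ (Subtype.val : (σ '' A : Set 𝕄) → 𝕄) := fun τ => rfl
    have hgσ : (σ ∘ (Subtype.val : A → 𝕄)) ∘ g = Subtype.val := by
      rw [hg]
      exact funext fun y => σ.apply_symm_apply _
    have hD' := hD.preimage_comp g
    have hmem' : (fun x : A → 𝕄 => x ∘ g) ⁻¹' D ∈ 𝒰 := by
      rw [← ha.mem_iff (hD'.mono (union_subset ht.right hFB)), mem_preimage, hgσ]
      exact hmem
    have hgen : {x : A → 𝕄 | ∃ τ : 𝕄 ≃[L] 𝕄, Fixes τ M ∧ x = τ ∘ (Subtype.val : A → 𝕄) ∧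
        R n M (τ '' A) (M ∪ F)} ∈ 𝒰 :=
      h𝒰 ⟨univ, Filter.univ_mem, n, F, hF, hFB, fun τ h1 _ h3 => ⟨τ, h1, rfl, h3⟩⟩
    obtain ⟨x, hx, τ, hτ, rfl, hR⟩ := 𝒰.nonempty_of_mem (Filter.inter_mem hmem' hgen)
    refine ⟨τ.comp σ.symm, hτ.comp hσ.symm, ?_, ?_⟩
    · rw [← hg]
      exact hx
    · have : (τ.comp σ.symm) '' (σ '' A) = τ '' A := by
        rw [← image_comp]
        refine image_congr fun x _ => ?_
        simp
      rwa [this]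
  · exact ⟨D, hD, 0, ∅, finite_empty, empty_subset _, fun _ _ h2 _ => h2⟩

end Local

/-! ### The base case: heir independence -/

section Heirs

variable (L : FirstOrder.Language.{u, v}) {𝕄 : Type w} [L.Structure 𝕄]

/-- The properties which pass from a relation to its derived relation. -/
structure IsGood (κ : Cardinal.{w}) (R : Relation 𝕄) : Prop where
  stronger : ∀ M A B : Set 𝕄, IsTriple L κ M A B → R M A B → IndH L M A B
  invariance : Invariance L κ R
  left_monotonicity : LeftMonotonicity L κ R
  right_monotonicity : RightMonotonicity L κ R
  existence : Existence L κ R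
  right_extension : RightExtension L κ R
  isLocal : IsLocal L κ R

variable {L} {α β ι : Type*} {A B C M : Set 𝕄} {κ : Cardinal.{w}}

theorem indH_iff : IndH L M A B ↔ FinSat L M (M ∪ A) (Subtype.val : B → 𝕄) := by
  constructor
  · rintro h D ⟨φ, rfl⟩ hD
    obtain ⟨c, hc, hφ⟩ := h φ hD
    exact ⟨c, hφ, hc⟩
  · intro h φ hφ
    obtain ⟨c, hc, hcM⟩ := h _ ⟨φ, rfl⟩ hφ
    exact ⟨c, hcM, hc⟩

theorem indH_range_iff [Nonempty 𝕄] (hM : IsSmallModel L κ M) {a : α → 𝕄} (ha : M ⊆ range a) :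
    IndH L M (range a) B ↔ ∀ (n : ℕ) (φ : L.Formula (α ⊕ Fin n)) (b : Fin n → 𝕄),
      (∀ i, b i ∈ B) → φ.Realize (Sum.elim a b) →
        ∃ c : Fin n → 𝕄, (∀ i, c i ∈ M) ∧ φ.Realize (Sum.elim a c) := by
  rw [indH_iff, union_eq_right.2 ha]
  constructor
  · intro h n φ b hb hφ
    have hD : (range a).Definable L {c : Fin n → 𝕄 | φ.Realize (Sum.elim a c)} := by
      refine definable_iff_exists_formula_sum.2
        ⟨φ.relabel (Sum.map (fun i => ⟨a i, i, rfl⟩) id), ?_⟩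
      ext c
      rw [mem_ofPred_eq, mem_ofPred_eq, Formula.realize_relabel]
      refine iff_of_eq (congrArg φ.Realize ?_)
      ext (i | i) <;> rfl
    obtain ⟨c, hc, hcM⟩ := h.comp (fun i => (⟨b i, hb i⟩ : B)) _ hD hφ
    exact ⟨c, hcM, hc⟩
  · intro h D hD hmem
    obtain ⟨n, v, E, hv, hE, rfl⟩ := Definable.exists_fin hD
    obtain ⟨m, φ, b, hb, rfl⟩ := definable_iff_exists_formula_fin.1 hE
    choose g hg using hb
    have hrel : ∀ c : Fin n → 𝕄, (φ.relabel (Sum.elim Sum.inr (Sum.inl ∘ g))).Realize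
        (Sum.elim a c) ↔ φ.Realize (Sum.elim c b) := by
      intro c
      rw [Formula.realize_relabel]
      refine iff_of_eq (congrArg φ.Realize ?_)
      ext (i | i)
      exacts [rfl, hg i]
    obtain ⟨c, hcM, hc⟩ := h n (φ.relabel (Sum.elim Sum.inr (Sum.inl ∘ g)))
      (Subtype.val ∘ v) (fun i => (v i).2) ((hrel _).2 hmem)
    obtain ⟨x, -, hx⟩ := exists_mem_of_definable (α := Unit) hM.1 definable_univ
      ⟨fun _ => Classical.arbitrary 𝕄, mem_univ _⟩
    refine ⟨Function.extend v c fun _ => x (), ?_, fun i => ?_⟩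
    · have hext : Function.extend v c (fun _ => x ()) ∘ v = c :=
        funext fun k => hv.extend_apply _ _ k
      rw [mem_ofPred_eq, hext]
      exact (hrel _).1 hc
    · by_cases h : ∃ k, v k = i
      · obtain ⟨k, rfl⟩ := h
        rw [hv.extend_apply]
        exact hcM k
      · rw [Function.extend_apply' _ _ _ h]
        exact hx ()

theorem indH_iff_formula [Nonempty 𝕄] (hM : IsSmallModel L κ M) (hA : M ⊆ A) :
    IndH L M A B ↔ ∀ (n : ℕ) (φ : L.Formula (A ⊕ Fin n)) (b : Fin n → 𝕄),
      (∀ i, b i ∈ B) → φ.Realize (Sum.elim (Subtype.val : A → 𝕄) b) →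
        ∃ c : Fin n → 𝕄, (∀ i, c i ∈ M) ∧ φ.Realize (Sum.elim (Subtype.val : A → 𝕄) c) := by
  have := indH_range_iff (B := B) hM (a := (Subtype.val : A → 𝕄)) (by rwa [Subtype.range_coe])
  rwa [Subtype.range_coe] at this

theorem realize_elim_comp {n : ℕ} (φ : L.Formula (α ⊕ Fin n)) (σ : 𝕄 ≃[L] 𝕄) (a : α → 𝕄)
    (b : Fin n → 𝕄) : φ.Realize (Sum.elim (σ ∘ a) (σ ∘ b)) ↔ φ.Realize (Sum.elim a b) := by
  rw [← Sum.comp_elim, StrongHomClass.realize_formula]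

theorem realize_elim_comp_symm {n : ℕ} (φ : L.Formula (α ⊕ Fin n)) (σ : 𝕄 ≃[L] 𝕄) (a : α → 𝕄)
    (b : Fin n → 𝕄) : φ.Realize (Sum.elim (σ.symm ∘ a) b) ↔ φ.Realize (Sum.elim a (σ ∘ b)) := by
  rw [← realize_elim_comp φ σ, comp_symm_comp]

theorem invariance_indH : Invariance L κ (IndH L : Relation 𝕄) := by
  intro σ M A B ht h
  rw [indH_iff] at h ⊢
  have := h.image σ
  rw [image_union] at this
  have h2 := this.comp fun y : (σ '' B : Set 𝕄) => (⟨σ.symm y, by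
    obtain ⟨x, hx, hxy⟩ := y.2
    rw [← hxy, Language.Equiv.symm_apply_apply]
    exact hx⟩ : B)
  convert! h2 using 1
  exact funext fun y => (σ.apply_symm_apply _).symm

theorem leftMonotonicity_indH : LeftMonotonicity L κ (IndH L : Relation 𝕄) := by
  intro M A A' B _ _ hA' h
  rw [indH_iff] at h ⊢
  exact h.mono (union_subset_union_right _ hA')

theorem rightMonotonicity_indH : RightMonotonicity L κ (IndH L : Relation 𝕄) := by
  intro M A B B' _ _ hB' h
  rw [indH_iff] at h ⊢
  exact h.comp (inclusion hB')

/-- Finite satisfiability concerns the right side, so `B` is moved to a coheir realization over `A`,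
and the automorphism is then undone. -/
theorem existence_indH (hm : IsMonster L 𝕄 κ) : Existence L κ (IndH L : Relation 𝕄) := by
  intro M A B ht
  have := hm.nonempty
  obtain ⟨𝒰, h𝒰, hB⟩ := (finSat_self ht.model (Subtype.val : B → 𝕄)).exists_generic
  obtain ⟨b, hb⟩ := exists_generic hm (α := B) (by simpa using ht.right_small) ht.left_small 𝒰
  obtain ⟨τ, hτ, rfl⟩ := (sameType_val_iff hm ht.model.2 ht.right_small).1
    (hB.sameType (hb.mono ht.left))
  refine ⟨τ.symm ∘ Subtype.val, hτ.symm.sameType _, ?_⟩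
  have h := (hb.finSat h𝒰).image τ.symm
  rw [range_comp_val, indH_iff, union_eq_right.2 (hτ.symm.subset_image ht.left)]
  rwa [hτ.symm.image_eq, symm_comp_comp] at h

/-- Extend the coheir of `B` over `A` to the variables of `C`, keeping the type of `C` over `M`, and
realize it over `A` with the `B`-part equal to `B`. An automorphism taking `C` to this realization
fixes `B`; its inverse moves `A`. -/
theorem rightExtension_indH (hm : IsMonster L 𝕄 κ) :
    RightExtension L κ (IndH L : Relation 𝕄) := by
  intro M A B C ht hBC hC h
  have := hm.nonempty
  rw [indH_iff, union_eq_right.2 ht.left] at h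
  obtain ⟨𝒰, h𝒰, hB⟩ := h.exists_generic
  obtain ⟨𝒱, h𝒱, h𝒱𝒰, hC𝒱⟩ := h𝒰.exists_extension ht.model (inclusion_injective hBC)
    (a := (Subtype.val : C → 𝕄)) (hB.mono ht.left)
  obtain ⟨c, hc⟩ := exists_generic hm (α := C) (by simpa using hC) ht.left_small 𝒱
  have hcB := hc.comp (inclusion hBC)
  rw [h𝒱𝒰] at hcB
  obtain ⟨ρ, hρ, hρc⟩ := exists_equiv_of_sameType hm ht.left_small
    (mk_range_lt (by simpa using ht.right_small)) (hcB.sameType hB)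
  have hρc' := hc.image h𝒱 (hρ.mono ht.left)
  rw [hρ.image_eq] at hρc'
  obtain ⟨τ, hτ, hτc⟩ := (sameType_val_iff hm ht.model.2 hC).1
    (hC𝒱.sameType (hρc'.mono ht.left))
  have hτB : Fixes τ B := by
    intro x hx
    have h1 := congrFun hτc ⟨x, hBC hx⟩
    have h2 := congrFun hρc ⟨x, hx⟩
    exact h1.trans h2
  refine ⟨τ.symm ∘ Subtype.val, hτB.symm.sameType _, ?_⟩
  have h := (hρc'.finSat h𝒱).image τ.symm
  rw [range_comp_val, indH_iff, union_eq_right.2 (hτ.symm.subset_image ht.left)]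
  rwa [hτ.symm.image_eq, ← hτc, symm_comp_comp] at h

theorem isLocal_indH (hm : IsMonster L 𝕄 κ) : IsLocal L κ (IndH L : Relation 𝕄) := by
  intro M A B ht h
  have := hm.nonempty
  rw [indH_iff_formula ht.model ht.left]
  intro n φ b hb hφ
  obtain ⟨σ, hσ, hσD, hR⟩ := h (range b) (finite_range b) (range_subset_iff.2 hb)
    {x | φ.Realize (Sum.elim x b)} (definable_formula_fin φ fun i => Or.inr ⟨i, rfl⟩) hφ
  rw [← range_comp_val, indH_range_iff ht.model
    (by rw [range_comp_val]; exact hσ.subset_image ht.left)] at hR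
  obtain ⟨c, hcM, hc⟩ := hR n φ b (fun i => Or.inr ⟨i, rfl⟩) hσD
  have hσc : σ ∘ c = c := funext fun i => hσ _ (hcM i)
  refine ⟨c, hcM, ?_⟩
  rwa [← realize_elim_comp φ σ, hσc]

theorem isGood_indH (hm : IsMonster L 𝕄 κ) : IsGood L κ (IndH L : Relation 𝕄) :=
  ⟨fun _ _ _ _ h => h, invariance_indH, leftMonotonicity_indH, rightMonotonicity_indH,
    existence_indH hm, rightExtension_indH hm, isLocal_indH hm⟩

end Heirs

/-! ### The derived relation: formal properties -/

section Derived

variable {L : FirstOrder.Language.{u, v}} {𝕄 : Type w} [L.Structure 𝕄]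
variable {α β ι : Type*} {A B C M : Set 𝕄} {κ : Cardinal.{w}} {R S : Relation 𝕄}

/-- `derived` for tuples in place of sets. -/
def DerivedTuple (L : FirstOrder.Language.{u, v}) [L.Structure 𝕄] (R : Relation 𝕄) (M : Set 𝕄)
    {α : Type*} (a : α → 𝕄) (B : Set 𝕄) : Prop :=
  ∀ (n : ℕ) (φ : L.Formula (α ⊕ Fin n)) (b : Fin n → 𝕄), (∀ i, b i ∈ B) →
    φ.Realize (Sum.elim a b) → ¬ HKimForks R M a φ b

theorem HKimDivides.hKimForks {a : α → 𝕄} {n : ℕ} {φ : L.Formula (α ⊕ Fin n)} {b : Fin n → 𝕄}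
    (h : HKimDivides R M a φ b) : HKimForks R M a φ b :=
  ⟨1, fun _ => n, fun _ => φ, fun _ => b, fun _ => h, fun _ hx => ⟨0, hx⟩⟩

theorem HKimDivides.congr {a a' : α → 𝕄} (ha : SameType L M a a') {n : ℕ}
    {φ : L.Formula (α ⊕ Fin n)} {b : Fin n → 𝕄} (h : HKimDivides R M a φ b) :
    HKimDivides R M a' φ b := by
  obtain ⟨c, hc, hcb, hinc⟩ := h
  exact ⟨c, hc, hcb, fun ⟨a'', h1, h2⟩ => hinc ⟨a'', ha.trans h1, h2⟩⟩

theorem HKimForks.congr {a a' : α → 𝕄} (ha : SameType L M a a') {n : ℕ}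
    {φ : L.Formula (α ⊕ Fin n)} {b : Fin n → 𝕄} (h : HKimForks R M a φ b) :
    HKimForks R M a' φ b := by
  obtain ⟨k, m, ψ, c, hdiv, himp⟩ := h
  exact ⟨k, m, ψ, c, fun j => (hdiv j).congr ha, himp⟩

theorem mk_range_lt_of_sameType (hm : IsMonster L 𝕄 κ) (hM : Cardinal.mk M < κ) {a a' : α → 𝕄}
    (ha : Cardinal.mk (range a) < κ) (h : SameType L M a a') : Cardinal.mk (range a') < κ := by
  obtain ⟨σ, -, rfl⟩ := exists_equiv_of_sameType hm hM ha h
  rw [range_comp]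
  exact mk_image_lt _ ha

/-- The pairs of sets which occur in the definition of `HKimDivides` are among those considered. -/
theorem isTriple_of_sameType (hm : IsMonster L 𝕄 κ) (hM : IsSmallModel L κ M) {a a' : α → 𝕄}
    (ha : Cardinal.mk (range a) < κ) (h : SameType L M a a') {n : ℕ} (c : ℕ → Fin n → 𝕄) :
    IsTriple L κ M (M ∪ range a') (M ∪ ⋃ i, range (c i)) :=
  ⟨hM, subset_union_left, subset_union_left,
    mk_union_lt hm hM.2 (mk_range_lt_of_sameType hm hM.2 ha h),
    mk_union_lt hm hM.2 (mk_countable_lt hm (countable_iUnion fun _ => countable_range _))⟩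

theorem HKimDivides.relabel (hm : IsMonster L 𝕄 κ) (hR : LeftMonotonicity L κ R)
    (hM : IsSmallModel L κ M) {a : α → 𝕄} (ha : Cardinal.mk (range a) < κ) (g : β → α) {n : ℕ}
    {φ : L.Formula (β ⊕ Fin n)} {b : Fin n → 𝕄} (h : HKimDivides R M (a ∘ g) φ b) :
    HKimDivides R M a (φ.relabel (Sum.map g id) : L.Formula (α ⊕ Fin n)) b := by
  obtain ⟨c, hc, hcb, hinc⟩ := h
  refine ⟨c, hc, hcb, fun ⟨a', h1, h2, h3⟩ => hinc ⟨a' ∘ g, h1.comp g, ?_, fun i => ?_⟩⟩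
  · exact hR M _ _ _ (isTriple_of_sameType hm hM ha h1 c) subset_union_left
      (union_subset_union_right _ (range_comp_subset_range _ _)) h2
  · have := h3 i
    rwa [Formula.realize_relabel, Sum.elim_comp_map, Function.comp_id] at this

theorem HKimForks.relabel (hm : IsMonster L 𝕄 κ) (hR : LeftMonotonicity L κ R)
    (hM : IsSmallModel L κ M) {a : α → 𝕄} (ha : Cardinal.mk (range a) < κ) (g : β → α) {n : ℕ}
    {φ : L.Formula (β ⊕ Fin n)} {b : Fin n → 𝕄} (h : HKimForks R M (a ∘ g) φ b) :
    HKimForks R M a (φ.relabel (Sum.map g id) : L.Formula (α ⊕ Fin n)) b := by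
  obtain ⟨k, m, ψ, c, hdiv, himp⟩ := h
  refine ⟨k, m, fun j => (ψ j).relabel (Sum.map g id), c,
    fun j => (hdiv j).relabel hm hR hM ha g, fun x hx => ?_⟩
  rw [Formula.realize_relabel, Sum.elim_comp_map, Function.comp_id] at hx
  obtain ⟨j, hj⟩ := himp _ hx
  refine ⟨j, ?_⟩
  rwa [Formula.realize_relabel, Sum.elim_comp_map, Function.comp_id]

theorem DerivedTuple.comp (hm : IsMonster L 𝕄 κ) (hR : LeftMonotonicity L κ R)
    (hM : IsSmallModel L κ M) {a : α → 𝕄} (ha : Cardinal.mk (range a) < κ)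
    (h : DerivedTuple L R M a B) (g : β → α) : DerivedTuple L R M (a ∘ g) B := by
  intro n φ b hb hφ hf
  refine h n (φ.relabel (Sum.map g id)) b hb ?_ (hf.relabel hm hR hM ha g)
  rwa [Formula.realize_relabel, Sum.elim_comp_map, Function.comp_id]

/-- Left monotonicity makes forking insensitive to adding or repeating coordinates, so the
enumeration of the set is immaterial. -/
theorem derived_range_iff (hm : IsMonster L 𝕄 κ) (hR : LeftMonotonicity L κ R)
    (hM : IsSmallModel L κ M) {a : α → 𝕄} (ha : Cardinal.mk (range a) < κ) :
    derived L R M (range a) B ↔ DerivedTuple L R M a B := by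
  constructor
  · intro h
    exact DerivedTuple.comp (a := (Subtype.val : range a → 𝕄)) hm hR hM (by rwa [Subtype.range_coe]) h
      (rangeFactorization a)
  · intro h
    have := h.comp hm hR hM ha (rangeSplitting a)
    rwa [show a ∘ rangeSplitting a = Subtype.val from funext (apply_rangeSplitting a)] at this

/-- Forking depends only on the type over `M`, so the forking formulas for `A` and for its conjugate
are the same. -/
theorem derived_image_iff (hm : IsMonster L 𝕄 κ) (hR : LeftMonotonicity L κ R)
    (ht : IsTriple L κ M A B) {σ : 𝕄 ≃[L] 𝕄} (hσ : Fixes σ M) :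
    derived L R M (σ '' A) B ↔ ∀ (n : ℕ) (φ : L.Formula (A ⊕ Fin n)) (b : Fin n → 𝕄),
      (∀ i, b i ∈ B) → φ.Realize (Sum.elim (σ ∘ (Subtype.val : A → 𝕄)) b) →
        ¬ HKimForks R M (Subtype.val : A → 𝕄) φ b := by
  rw [← range_comp_val, derived_range_iff hm hR ht.model
    (by rw [range_comp_val]; exact mk_image_lt _ ht.left_small)]
  have hst := hσ.sameType (Subtype.val : A → 𝕄)
  exact ⟨fun h n φ b hb hφ hf => h n φ b hb hφ (hf.congr hst),
    fun h n φ b hb hφ hf => h n φ b hb hφ (hf.congr hst.symm)⟩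

theorem HKimDivides.image (hm : IsMonster L 𝕄 κ) (hR : Invariance L κ R)
    (hM : IsSmallModel L κ M) {a : α → 𝕄} (ha : Cardinal.mk (range a) < κ) (σ : 𝕄 ≃[L] 𝕄) {n : ℕ}
    {φ : L.Formula (α ⊕ Fin n)} {b : Fin n → 𝕄} (h : HKimDivides R M a φ b) :
    HKimDivides R (σ '' M) (σ ∘ a) φ (σ ∘ b) := by
  have := hm.nonempty
  obtain ⟨c, hc, hcb, hinc⟩ := h
  refine ⟨fun i => σ ∘ c i, hc.image σ, by simp only [hcb],
    fun ⟨a', h1, h2, h3⟩ => hinc ⟨σ.symm ∘ a', ?_, ?_, fun i => ?_⟩⟩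
  · have := h1.image σ.symm
    rwa [image_symm_image, symm_comp_comp] at this
  · have ht := isTriple_of_sameType hm (hM.image σ)
      (by rw [range_comp]; exact mk_image_lt _ ha) h1 (fun i => σ ∘ c i)
    have := hR σ.symm _ _ _ ht h2
    simp only [image_union, image_iUnion, ← range_comp, symm_comp_comp, image_symm_image] at this
    exact this
  · rw [realize_elim_comp_symm]
    exact h3 i

theorem HKimForks.image (hm : IsMonster L 𝕄 κ) (hR : Invariance L κ R)
    (hM : IsSmallModel L κ M) {a : α → 𝕄} (ha : Cardinal.mk (range a) < κ) (σ : 𝕄 ≃[L] 𝕄) {n : ℕ}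
    {φ : L.Formula (α ⊕ Fin n)} {b : Fin n → 𝕄} (h : HKimForks R M a φ b) :
    HKimForks R (σ '' M) (σ ∘ a) φ (σ ∘ b) := by
  obtain ⟨k, m, ψ, c, hdiv, himp⟩ := h
  refine ⟨k, m, ψ, fun j => σ ∘ c j, fun j => (hdiv j).image hm hR hM ha σ, fun x hx => ?_⟩
  obtain ⟨j, hj⟩ := himp (σ.symm ∘ x) ((realize_elim_comp_symm φ σ _ _).2 hx)
  exact ⟨j, (realize_elim_comp_symm _ σ _ _).1 hj⟩

/-- The derived relation is monotone in the relation. -/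
theorem derived_mono (hm : IsMonster L 𝕄 κ) (hRS : ∀ M A B, IsTriple L κ M A B → R M A B → S M A B)
    (ht : IsTriple L κ M A B) (h : derived L R M A B) : derived L S M A B := by
  intro n φ b hb hφ ⟨k, m, ψ, c, hdiv, himp⟩
  refine h n φ b hb hφ ⟨k, m, ψ, c, fun j => ?_, himp⟩
  obtain ⟨c', hc', hcb, hinc⟩ := hdiv j
  refine ⟨c', hc', hcb, fun ⟨a', h1, h2, h3⟩ => hinc ⟨a', h1, ?_, h3⟩⟩
  exact hRS _ _ _ (isTriple_of_sameType hm ht.model (by simpa using ht.left_small) h1 c') h2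

/-- A formula of the type with no solution in `M` divides along any coheir Morley sequence starting
at its parameter: a realization independent from the sequence would be heir independent from it,
giving a solution in `M`. -/
theorem indH_of_derived (hm : IsMonster L 𝕄 κ)
    (hR : ∀ M A B, IsTriple L κ M A B → R M A B → IndH L M A B)
    (ht : IsTriple L κ M A B) (h : derived L R M A B) : IndH L M A B := by
  have := hm.nonempty
  rw [indH_iff_formula ht.model ht.left]
  intro n φ b hb hφ
  by_contra hcon
  obtain ⟨c, hc, hcb⟩ := exists_isCoheirMorley hm ht.model b
  refine h n φ b hb hφ (HKimDivides.hKimForks ⟨c, hc, hcb, ?_⟩)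
  rintro ⟨a', h1, h2, h3⟩
  have h2' := hR _ _ _ (isTriple_of_sameType hm ht.model (by simpa using ht.left_small) h1 c) h2
  obtain ⟨σ, hσ, rfl⟩ := (sameType_val_iff hm ht.model.2 ht.left_small).1 h1
  have hMσ : M ⊆ range (σ ∘ (Subtype.val : A → 𝕄)) := by
    rw [range_comp_val]
    exact hσ.subset_image ht.left
  rw [union_eq_right.2 hMσ, indH_range_iff ht.model hMσ] at h2'
  obtain ⟨d, hdM, hd⟩ := h2' n φ (c 0) (fun i => Or.inr (mem_iUnion.2 ⟨0, i, rfl⟩)) (h3 0)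
  have hσd : σ ∘ d = d := funext fun i => hσ _ (hdM i)
  refine hcon ⟨d, hdM, ?_⟩
  rwa [← realize_elim_comp φ σ, hσd]

theorem invariance_derived (hm : IsMonster L 𝕄 κ) (hR : IsGood L κ R) :
    Invariance L κ (derived L R) := by
  intro σ M A B ht h
  have := hm.nonempty
  rw [← range_comp_val σ A, derived_range_iff hm hR.left_monotonicity (ht.model.image σ)
    (by rw [range_comp_val]; exact mk_image_lt _ ht.left_small)]
  intro n φ b hb hφ hf
  have hf' := hf.image hm hR.invariance (ht.model.image σ)
    (by rw [range_comp_val]; exact mk_image_lt _ ht.left_small) σ.symm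
  rw [image_symm_image, symm_comp_comp] at hf'
  refine h n φ (σ.symm ∘ b) (fun i => ?_) ?_ hf'
  · obtain ⟨x, hx, hxb⟩ := hb i
    rw [Function.comp_apply, ← hxb, Language.Equiv.symm_apply_apply]
    exact hx
  · rwa [← realize_elim_comp φ σ, comp_symm_comp]

theorem leftMonotonicity_derived (hm : IsMonster L 𝕄 κ) (hR : IsGood L κ R) :
    LeftMonotonicity L κ (derived L R) := by
  intro M A A' B ht _ hA' h
  exact DerivedTuple.comp (a := (Subtype.val : A → 𝕄)) hm hR.left_monotonicity ht.model
    (by simpa using ht.left_small) h (inclusion hA')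

theorem rightMonotonicity_derived : RightMonotonicity L κ (derived L R) :=
  fun _ _ _ _ _ _ hB' h n φ b hb => h n φ b fun i => hB' (hb i)

/-- A violation is a single forking formula with finitely many parameters, which some conjugate
independent from these would realize. -/
theorem isLocal_derived (hm : IsMonster L 𝕄 κ) (hR : IsGood L κ R) :
    IsLocal L κ (derived L R) := by
  intro M A B ht h n φ b hb hφ
  obtain ⟨σ, hσ, hσD, hR'⟩ := h (range b) (finite_range b) (range_subset_iff.2 hb)
    {x | φ.Realize (Sum.elim x b)} (definable_formula_fin φ fun i => Or.inr ⟨i, rfl⟩) hφ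
  exact (derived_image_iff hm hR.left_monotonicity (ht.subset_right subset_union_left
    (union_subset ht.right (range_subset_iff.2 hb))) hσ).1 hR' n φ b
      (fun i => Or.inr ⟨i, rfl⟩) hσD

end Derived

/-! ### Extension and existence for the derived relation -/

section ForkFilter

variable {L : FirstOrder.Language.{u, v}} {𝕄 : Type w} [L.Structure 𝕄]
variable {α β ι : Type*} {A B C M : Set 𝕄} {κ : Cardinal.{w}} {R S : Relation 𝕄}

/-- The set `D` is defined by a formula which `h`-Kim-divides with respect to `tp(a/M)`. -/
def IsDividing (L : FirstOrder.Language.{u, v}) [L.Structure 𝕄] (R : Relation 𝕄) (M : Set 𝕄)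
    {α : Type*} (a : α → 𝕄) (D : Set (α → 𝕄)) : Prop :=
  ∃ (n : ℕ) (φ : L.Formula (α ⊕ Fin n)) (b : Fin n → 𝕄), HKimDivides R M a φ b ∧
    D = {x | φ.Realize (Sum.elim x b)}

/-- The filter of the sets whose complement is covered by finitely many dividing sets. -/
def forkFilter (L : FirstOrder.Language.{u, v}) [L.Structure 𝕄] (R : Relation 𝕄) (M : Set 𝕄)
    {α : Type*} (a : α → 𝕄) : Filter (α → 𝕄) where
  sets := {W | ∃ 𝒟 : Set (Set (α → 𝕄)), 𝒟.Finite ∧ (∀ D ∈ 𝒟, IsDividing L R M a D) ∧ Wᶜ ⊆ ⋃₀ 𝒟}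
  univ_sets := ⟨∅, finite_empty, fun _ h => h.elim, by simp⟩
  sets_of_superset := fun ⟨𝒟, h1, h2, h3⟩ h => ⟨𝒟, h1, h2, (compl_subset_compl.2 h).trans h3⟩
  inter_sets := by
    rintro W W' ⟨𝒟, h1, h2, h3⟩ ⟨𝒟', h1', h2', h3'⟩
    refine ⟨𝒟 ∪ 𝒟', h1.union h1', fun D hD => hD.elim (h2 D) (h2' D), ?_⟩
    rw [compl_inter, sUnion_union]
    exact union_subset_union h3 h3'

theorem hKimForks_iff {a : α → 𝕄} {n : ℕ} {φ : L.Formula (α ⊕ Fin n)} {b : Fin n → 𝕄} :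
    HKimForks R M a φ b ↔ {x | φ.Realize (Sum.elim x b)}ᶜ ∈ forkFilter L R M a := by
  constructor
  · rintro ⟨k, m, ψ, c, hdiv, himp⟩
    refine ⟨range fun j => {x | (ψ j).Realize (Sum.elim x (c j))}, finite_range _, ?_, ?_⟩
    · rintro _ ⟨j, rfl⟩
      exact ⟨_, _, _, hdiv j, rfl⟩
    · rw [compl_compl]
      intro x hx
      obtain ⟨j, hj⟩ := himp x hx
      exact ⟨_, ⟨j, rfl⟩, hj⟩
  · rintro ⟨𝒟, hfin, hdiv, hsub⟩
    rw [compl_compl] at hsub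
    have := hfin.to_subtype
    obtain ⟨k, ⟨f⟩⟩ := Finite.exists_equiv_fin 𝒟
    choose m ψ c hdiv hD using fun j : Fin k => hdiv _ (f.symm j).2
    refine ⟨k, m, ψ, c, hdiv, fun x hx => ?_⟩
    obtain ⟨D, hD', hxD⟩ := hsub hx
    refine ⟨f ⟨D, hD'⟩, ?_⟩
    have := hD (f ⟨D, hD'⟩)
    rw [_root_.Equiv.symm_apply_apply] at this
    have hx' : x ∈ ((⟨D, hD'⟩ : 𝒟) : Set (α → 𝕄)) := hxD
    rw [this] at hx'
    exact hx'

/-- No formula of the type of `a` over `B` forks if and only if this type is compatible with the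
filter of complements of forking formulas. -/
theorem derivedTuple_iff {a : α → 𝕄} :
    DerivedTuple L R M a B ↔ (typeFilter L B a ⊓ forkFilter L R M a).NeBot := by
  rw [Filter.inf_neBot_iff]
  constructor
  · rintro h W ⟨D, hD, ha, hDW⟩ W' hW'
    by_contra hcon
    obtain ⟨n, φ, b, hb, rfl⟩ := definable_iff_exists_formula_fin.1 hD
    refine h n φ b hb ha (hKimForks_iff.2 (Filter.mem_of_superset hW' fun x hx hxD => ?_))
    exact hcon ⟨x, hDW hxD, hx⟩
  · intro h n φ b hb hφ hf
    obtain ⟨x, hx, hx'⟩ := h (Definable.mem_typeFilter (definable_formula_fin φ hb) hφ)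
      (hKimForks_iff.1 hf)
    exact hx' hx

theorem derived_iff : derived L R M A B ↔
    (typeFilter L B (Subtype.val : A → 𝕄) ⊓ forkFilter L R M (Subtype.val : A → 𝕄)).NeBot :=
  derivedTuple_iff

/-- An ultrafilter refining the type over `B` and the fork filter contains no forking formula;
realize it over `C`. -/
theorem rightExtension_derived (hm : IsMonster L 𝕄 κ) (hR : IsGood L κ R) :
    RightExtension L κ (derived L R) := by
  intro M A B C ht hBC hC h
  have := derived_iff.1 h
  obtain ⟨𝒰, h𝒰⟩ := Ultrafilter.exists_le
    (typeFilter L B (Subtype.val : A → 𝕄) ⊓ forkFilter L R M (Subtype.val : A → 𝕄))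
  obtain ⟨a, ha⟩ := exists_generic hm (α := A) (by simpa using ht.left_small) hC 𝒰
  have haB : Generic L 𝒰 B (Subtype.val : A → 𝕄) := generic_iff_le.2 (h𝒰.trans inf_le_left)
  have hst := haB.sameType (ha.mono hBC)
  refine ⟨a, hst, ?_⟩
  have hstM := hst.mono ht.right
  rw [derived_range_iff hm hR.left_monotonicity ht.model
    (mk_range_lt_of_sameType hm ht.model.2 (by simpa using ht.left_small) hstM)]
  intro n φ b hb hφ hf
  have h1 := (ha.mem_iff (definable_formula_fin φ hb)).1 hφ
  have h2 := h𝒰.trans inf_le_right (hKimForks_iff.1 (hf.congr hstM.symm))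
  exact Ultrafilter.compl_mem_iff_notMem.1 h2 h1

/-- If the instances of `φ` along the sequence `c` are inconsistent for a local relation, then this
already holds along a finite part of the sequence. -/
theorem HInconsistent.exists_finite (hm : IsMonster L 𝕄 κ) (hR : IsGood L κ R)
    (hM : IsSmallModel L κ M) (hA : M ⊆ A) (hAs : Cardinal.mk A < κ) {n : ℕ}
    {φ : L.Formula (A ⊕ Fin n)} {c : ℕ → Fin n → 𝕄}
    (h : HInconsistent R M (Subtype.val : A → 𝕄) φ c) :
    ∃ N, ∀ σ : 𝕄 ≃[L] 𝕄, Fixes σ M → R M (σ '' A) (prior M c N) →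
      ∃ i < N, ¬ φ.Realize (Sum.elim (σ ∘ (Subtype.val : A → 𝕄)) (c i)) := by
  by_contra hcon
  push Not at hcon
  have ht : IsTriple L κ M A (M ∪ ⋃ i, range (c i)) := ⟨hM, hA, subset_union_left, hAs,
    mk_union_lt hm hM.2 (mk_countable_lt hm (countable_iUnion fun _ => countable_range _))⟩
  have hprior : ∀ N, prior M c N ⊆ M ∪ ⋃ i, range (c i) := fun N =>
    prior_subset subset_union_left fun j _ =>
      subset_union_of_subset_right (subset_iUnion (fun i => range (c i)) j) _
  -- If every finite part were consistent, compactness for this filter would realize all instances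
  -- by a conjugate independent from the whole sequence.
  let 𝒢 : Filter (A → 𝕄) :=
    ⨅ N : ℕ, Filter.principal {x | ∀ i < N, φ.Realize (Sum.elim x (c i))}
  have hbasis : ∀ W, W ∈ 𝒢 ↔ ∃ N : ℕ, {x | ∀ i < N, φ.Realize (Sum.elim x (c i))} ⊆ W := by
    intro W
    rw [Filter.mem_iInf_of_directed]
    · rfl
    · refine Antitone.directed_ge fun N N' hN => ?_
      exact Filter.principal_mono.2 fun x hx i hi => hx i (hi.trans_le hN)
  obtain ⟨σ, hσ, hσR, hσD⟩ := exists_equiv_of_isLocal hm (R := fun _ => R) (fun _ => hR.isLocal)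
    (fun _ _ _ _ _ _ _ h => h) (fun _ => hR.right_monotonicity) ht 𝒢 (by
      intro W hW _ F hF hFB
      obtain ⟨N, hN⟩ := (hbasis W).1 hW
      obtain ⟨N', hN'⟩ : ∃ N', F ⊆ prior M c N' := by
        induction F, hF using Set.Finite.induction_on with
        | empty => exact ⟨0, empty_subset _⟩
        | insert _ _ ih =>
          rename_i x F _ _
          obtain ⟨N1, h1⟩ := ih ((subset_insert _ _).trans hFB)
          rcases hFB (mem_insert _ _) with hx | hx
          · exact ⟨N1, insert_subset (subset_prior _ _ hx) h1⟩
          · obtain ⟨i, hi⟩ := mem_iUnion.1 hx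
            refine ⟨max N1 (i + 1), insert_subset ?_ (h1.trans ?_)⟩
            · exact range_subset_prior (lt_of_lt_of_le i.lt_succ_self (le_max_right _ _)) hi
            · exact prior_subset (subset_prior _ _) fun j hj =>
                range_subset_prior (hj.trans_le (le_max_left _ _))
      obtain ⟨σ, hσ, hσR, hσφ⟩ := hcon (max N N')
      refine ⟨σ, hσ, hN fun i hi => hσφ i (hi.trans_le (le_max_left _ _)), ?_⟩
      refine hR.right_monotonicity M _ _ _
        ((ht.image_left hσ).subset_right (subset_prior _ _) (hprior _)) subset_union_left
        (union_subset (subset_prior _ _) (hN'.trans ?_)) hσR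
      exact prior_subset (subset_prior _ _) fun j hj =>
        range_subset_prior (hj.trans_le (le_max_right _ _)))
  refine h ⟨σ ∘ Subtype.val, hσ.sameType _, ?_, fun i => ?_⟩
  · rw [range_comp_val, union_eq_right.2 (hσ.subset_image hA)]
    exact hσR 0
  · exact hσD {x | φ.Realize (Sum.elim x (c i))} ((hbasis _).2 ⟨i + 1, fun x hx => hx i i.lt_succ_self⟩)
      (definable_formula_fin φ fun k => Or.inr (mem_iUnion.2 ⟨i, k, rfl⟩))

/-- A type over `M` does not fork over `M`. -/
theorem derived_self (hm : IsMonster L 𝕄 κ) (hR : IsGood L κ R)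
    (hM : IsSmallModel L κ M) (hA : M ⊆ A) (hAs : Cardinal.mk A < κ) : derived L R M A M := by
  classical
  have := hm.nonempty
  rw [derived_iff, Filter.inf_neBot_iff]
  rintro W ⟨D, hD, hmem, hDW⟩ W' ⟨𝒟, hfin, hdiv, hsub⟩
  by_contra hcon
  have hD𝒟 : D ⊆ ⋃₀ 𝒟 := fun x hx => hsub fun hx' => hcon ⟨x, hDW hx, hx'⟩
  obtain ⟨D0, hD0, -⟩ := hD𝒟 hmem
  have := hfin.to_subtype
  obtain ⟨k, ⟨f⟩⟩ := Finite.exists_equiv_fin 𝒟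
  -- The broom takes coheirs indexed by all of `ℕ`; indices from `k` on repeat `D0`.
  let g : ℕ → 𝒟 := fun j => if h : j < k then f.symm ⟨j, h⟩ else ⟨D0, hD0⟩
  have hg : ∀ D : 𝒟, ∃ j < k, g j = D := fun D => ⟨f D, (f D).2, by simp [g]⟩
  choose n φ b hdiv hφ using fun j => hdiv _ (g j).2
  choose c hc hcb hinc using hdiv
  choose 𝒰 h𝒰 hgen using fun j => isCoheirMorley_iff.1 (hc j)
  choose N hN using fun j => (hinc j).exists_finite hm hR hM hA hAs
  let N' := (Finset.range k).sup N
  have hN' : ∀ j < k, N j ≤ N' := fun j hj => Finset.le_sup (Finset.mem_range.2 hj)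
  -- All parameters are concatenated, so that one automorphism moves them simultaneously.
  let d : (Σ j, Fin (n j)) → 𝕄 := fun x => b x.1 x.2
  obtain ⟨T, hT⟩ := exists_broom (e := fun j => Sigma.mk j) hm hM h𝒰 N' k
    (fun j _ => sigma_mk_injective) d fun j _ => by
      have := (hgen j 0).mono (subset_prior _ _)
      rw [hcb] at this
      exact this
  let E : Set 𝕄 := M ∪ ⋃ t ∈ T, range (t ∘ d)
  have ht : IsTriple L κ M A E := ⟨hM, hA, subset_union_left, hAs, mk_union_lt hm hM.2
    (mk_countable_lt hm (hT.finite.countable.biUnion fun _ _ => countable_range _))⟩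
  obtain ⟨σ, hσ, hσR⟩ := hR.existence.exists_equiv hm ht
  -- Since `D` is `M`-definable, each `τ.symm` keeps the copy of `A` inside it, so some disjunct
  -- holds there. Moved by `τ`, it holds of the copy itself with parameter `τ ∘ b j`, which colours
  -- `τ` by `j`.
  obtain ⟨j, hj, t, htT, htgen⟩ := hT.hasBranch
    (fun τ j => (φ j).Realize (Sum.elim (σ ∘ (Subtype.val : A → 𝕄)) (τ ∘ b j))) (by
      intro τ hτ
      have h1 : τ.symm ∘ (σ ∘ (Subtype.val : A → 𝕄)) ∈ D :=
        (Definable.comp_mem_iff hD (hT.fixes τ hτ).symm _).2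
          ((Definable.comp_mem_iff hD hσ _).2 hmem)
      obtain ⟨D1, hD1, hx⟩ := hD𝒟 h1
      obtain ⟨j, hj, hgj⟩ := hg ⟨D1, hD1⟩
      refine ⟨j, hj, (realize_elim_comp_symm _ τ _ _).1 ?_⟩
      have hx' : τ.symm ∘ (σ ∘ (Subtype.val : A → 𝕄)) ∈ ((g j : 𝒟) : Set (A → 𝕄)) := by
        rw [hgj]
        exact hx
      rw [hφ j] at hx'
      exact hx')
  -- The branch is conjugate over `M` to an initial segment of `c j`, where `N j` instances are
  -- already inconsistent.
  obtain ⟨ρ, hρ, hρc⟩ := exists_equiv_of_generic (n := N j) hm hM.2 (h𝒰 j)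
    (fun i hi => htgen i (hi.trans_le (hN' j hj))) (fun i _ => hgen j i)
    (fun i _ => mk_countable_lt hm (countable_range _))
    (fun i _ => mk_countable_lt hm (countable_range _))
  have hbt : ∀ i < N j, ρ ∘ (t i ∘ b j) = c j i := hρc
  have hρR := hR.invariance ρ _ _ _ (ht.image_left hσ) hσR
  have hρt := (ht.image_left hσ).image ρ
  rw [hρ.image_eq] at hρR hρt
  have hpr : prior M (c j) (N j) ⊆ ρ '' E := by
    refine prior_subset hρt.right fun i hi => ?_
    rw [← hbt i hi, range_comp]
    refine image_mono (subset_union_of_subset_right ?_ _)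
    refine subset_iUnion₂_of_subset (t i) (htT i (hi.trans_le (hN' j hj))).1 ?_
    rintro _ ⟨l, rfl⟩
    exact ⟨⟨j, l⟩, rfl⟩
  have h2 := hR.right_monotonicity M _ _ _ hρt (subset_prior (c j) (N j)) hpr hρR
  rw [← image_comp] at h2
  obtain ⟨i, hi, hni⟩ := hN j (ρ.comp σ) (hρ.comp hσ) h2
  refine hni ?_
  rw [coe_comp, ← hbt i hi, realize_elim_comp]
  exact (htT i (hi.trans_le (hN' j hj))).2

theorem existence_derived (hm : IsMonster L 𝕄 κ) (hR : IsGood L κ R) :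
    Existence L κ (derived L R) := fun M A B ht =>
  rightExtension_derived hm hR M A M B
    ⟨ht.model, ht.left, Subset.rfl, ht.left_small, ht.model.2⟩ ht.right ht.right_small
    (derived_self hm hR ht.model ht.left ht.left_small)

theorem IsGood.derived (hm : IsMonster L 𝕄 κ) (hR : IsGood L κ R) :
    IsGood L κ (derived L R) where
  stronger _ _ _ ht := indH_of_derived hm hR.stronger ht
  invariance := invariance_derived hm hR
  left_monotonicity := leftMonotonicity_derived hm hR
  right_monotonicity := rightMonotonicity_derived
  existence := existence_derived hm hR
  right_extension := rightExtension_derived hm hR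
  isLocal := isLocal_derived hm hR

end ForkFilter

/-! ### The intersection: admissibility and maximality -/

section Intersection

variable {L : FirstOrder.Language.{u, v}} {𝕄 : Type w} [L.Structure 𝕄]
variable {A B C M : Set 𝕄} {κ : Cardinal.{w}}

theorem isGood_iter (hm : IsMonster L 𝕄 κ) (n : ℕ) : IsGood L κ (iter L n : Relation 𝕄) := by
  induction n with
  | zero => exact isGood_indH hm
  | succ n ih => exact ih.derived hm

/-- The first step holds because derived relations stay stronger than heir independence; the others
follow from monotonicity of the derivation. -/
theorem iter_of_iter_succ (hm : IsMonster L 𝕄 κ) (n : ℕ) (M A B : Set 𝕄)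
    (ht : IsTriple L κ M A B) (h : iter L (n + 1) M A B) : iter L n M A B := by
  induction n generalizing M A B with
  | zero => exact (isGood_iter hm 1).stronger M A B ht h
  | succ n ih => exact derived_mono hm ih ht h

theorem iter_antitone (hm : IsMonster L 𝕄 κ) (n m : ℕ) (hnm : n ≤ m) (M A B : Set 𝕄)
    (ht : IsTriple L κ M A B) (h : iter L m M A B) : iter L n M A B := by
  induction m, hnm using Nat.le_induction with
  | base => exact h
  | succ m _ ih => exact ih (iter_of_iter_succ hm m M A B ht h)

theorem exists_equiv_indCK (hm : IsMonster L 𝕄 κ) (ht : IsTriple L κ M A B) (𝒢 : Filter (A → 𝕄))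
    (h : ∀ W ∈ 𝒢, ∀ n, ∀ F : Set 𝕄, F.Finite → F ⊆ B → ∃ σ : 𝕄 ≃[L] 𝕄, Fixes σ M ∧
      σ ∘ (Subtype.val : A → 𝕄) ∈ W ∧ iter L n M (σ '' A) (M ∪ F)) :
    ∃ σ : 𝕄 ≃[L] 𝕄, Fixes σ M ∧ IndCK L M (σ '' A) B ∧
      ∀ D ∈ 𝒢, B.Definable L D → σ ∘ (Subtype.val : A → 𝕄) ∈ D :=
  exists_equiv_of_isLocal hm (fun n => (isGood_iter hm n).isLocal) (iter_antitone hm)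
    (fun n => (isGood_iter hm n).right_monotonicity) ht 𝒢 h

theorem existence_indCK (hm : IsMonster L 𝕄 κ) :
    Existence L κ (IndCK L : Relation 𝕄) := by
  intro M A B ht
  obtain ⟨σ, hσ, hR, -⟩ := exists_equiv_indCK hm ht ⊤ (by
    intro W hW n F _ hFB
    obtain ⟨σ, hσ, hR⟩ := (isGood_iter hm n).existence.exists_equiv hm ht
    refine ⟨σ, hσ, Filter.mem_top.1 hW ▸ mem_univ _, ?_⟩
    exact (isGood_iter hm n).right_monotonicity M _ _ _ (ht.image_left hσ) subset_union_left
      (union_subset ht.right hFB) hR)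
  exact ⟨σ ∘ Subtype.val, hσ.sameType _, by rwa [range_comp_val]⟩

theorem rightExtension_indCK (hm : IsMonster L 𝕄 κ) :
    RightExtension L κ (IndCK L : Relation 𝕄) := by
  intro M A B C ht hBC hC h
  have ht' := ht.with_right (ht.right.trans hBC) hC
  obtain ⟨σ, hσ, hR, hD⟩ := exists_equiv_indCK hm ht' (typeFilter L B Subtype.val) (by
    rintro W ⟨D, hD, hmem, hDW⟩ n F _ hFC
    obtain ⟨σ, hσ, hR⟩ := (isGood_iter hm n).right_extension.exists_equiv hm ht hBC hC (h n)
    have hσM := hσ.mono ht.right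
    refine ⟨σ, hσM, hDW ((Definable.comp_mem_iff hD hσ _).2 hmem), ?_⟩
    exact (isGood_iter hm n).right_monotonicity M _ _ _ (ht'.image_left hσM) subset_union_left
      (union_subset ht'.right hFC) hR)
  refine ⟨σ ∘ Subtype.val, sameType_of_imp fun D hDB hmem => ?_, by rwa [range_comp_val]⟩
  exact hD D (Definable.mem_typeFilter hDB hmem) (hDB.mono hBC)

/-- One formula and finitely many parameters of the coheir chain condition for the intersection. -/
theorem exists_equiv_chain (hm : IsMonster L 𝕄 κ) {ι : Type*} {b : ℕ → ι → 𝕄}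
    (ht : IsTriple L κ M A (M ∪ range (b 0))) (hb : IsCoheirMorley L M b)
    {θ : ℕ → (𝕄 ≃[L] 𝕄)} (hθ : ∀ i, Fixes (θ i) M) (hθb : ∀ i, θ i ∘ b 0 = b i) {n : ℕ}
    (h : iter L (n + 1) M A (M ∪ range (b 0))) {D : Set (A → 𝕄)}
    (hD : (M ∪ range (b 0)).Definable L D) (hmem : (Subtype.val : A → 𝕄) ∈ D) {F : Set 𝕄}
    (hF : F.Finite) (hFb : F ⊆ M ∪ ⋃ i, range (b i)) :
    ∃ σ : 𝕄 ≃[L] 𝕄, Fixes σ M ∧ (∀ i, (θ i).symm ∘ (σ ∘ (Subtype.val : A → 𝕄)) ∈ D) ∧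
      iter L n M (σ '' A) (M ∪ F) := by
  have := hm.nonempty
  obtain ⟨m, φ, d, hd, rfl⟩ := definable_iff_exists_formula_fin.1 hD
  have h1 : ∀ k, ∃ s : ι ⊕ M, Sum.elim (b 0) Subtype.val s = d k := by
    intro k
    rcases hd k with hk | ⟨s, hs⟩
    exacts [⟨Sum.inr ⟨_, hk⟩, rfl⟩, ⟨Sum.inl s, hs⟩]
  choose w₁ hw₁ using h1
  have h2 : ∀ y : F, ∃ (s : ι ⊕ M) (i : ℕ), Sum.elim (b i) Subtype.val s = y := by
    intro y
    rcases hFb y.2 with hy | hy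
    · exact ⟨Sum.inr ⟨_, hy⟩, 0, rfl⟩
    · obtain ⟨i, s, hs⟩ := mem_iUnion.1 hy
      exact ⟨Sum.inl s, i, hs⟩
  choose w₂ hw₂ using h2
  have := hF.to_subtype
  obtain ⟨q, ⟨e⟩⟩ := Finite.exists_equiv_fin F
  -- The first `m` coordinates carry the parameters of `D`. The last `q` are dummies for the
  -- formula; they make the sequence `c` cover `F`.
  let w : Fin (m + q) → ι ⊕ M := Fin.append w₁ (w₂ ∘ e.symm)
  let c : ℕ → Fin (m + q) → 𝕄 := fun i => Sum.elim (b i) Subtype.val ∘ w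
  have hc : IsCoheirMorley L M c := hb.subst w
  have hcd : ∀ i, c i ∘ Fin.castAdd q = θ i ∘ d := by
    intro i
    funext k
    have hθe : θ i ∘ Sum.elim (b 0) (Subtype.val : M → 𝕄) = Sum.elim (b i) Subtype.val := by
      rw [Sum.comp_elim, hθb]
      exact congrArg _ (funext fun x => hθ i _ x.2)
    have := congrFun hθe (w₁ k)
    simp only [Function.comp_apply, hw₁] at this
    simp only [c, w, Function.comp_apply, Fin.append_left]
    exact this.symm
  have hφ : ∀ (x : A → 𝕄) i, (φ.relabel (Sum.map id (Fin.castAdd q))).Realize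
      (Sum.elim x (c i)) ↔ φ.Realize (Sum.elim x (θ i ∘ d)) := by
    intro x i
    rw [Formula.realize_relabel, Sum.elim_comp_map, hcd, Function.comp_id]
  have hθ0 : θ 0 ∘ d = d := by
    rw [← hcd]
    funext k
    simp only [c, w, Function.comp_apply, Fin.append_left, hw₁]
  have hnot : ¬ HInconsistent (iter L n) M (Subtype.val : A → 𝕄)
      (φ.relabel (Sum.map id (Fin.castAdd q))) c := by
    intro hinc
    refine h (m + q) _ (c 0) (fun k => ?_) ((hφ _ 0).2 (by rwa [hθ0]))
      (HKimDivides.hKimForks ⟨c, hc, rfl, hinc⟩)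
    simp only [c, Function.comp_apply]
    rcases w k with s | x
    exacts [Or.inr ⟨s, rfl⟩, Or.inl x.2]
  obtain ⟨a', ha', hR, hφ'⟩ := not_not.1 hnot
  have ht' := isTriple_of_sameType hm ht.model (by simpa using ht.left_small) ha' c
  obtain ⟨σ, hσ, rfl⟩ := (sameType_val_iff hm ht.model.2 ht.left_small).1 ha'
  rw [range_comp_val, union_eq_right.2 (hσ.subset_image ht.left)] at hR ht'
  refine ⟨σ, hσ, fun i => ?_, ?_⟩
  · exact (realize_elim_comp_symm φ (θ i) _ _).2 ((hφ _ i).1 (hφ' i))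
  · refine (isGood_iter hm n).right_monotonicity M _ _ _ ht' subset_union_left
      (union_subset_union_right _ fun y hy => ?_) hR
    refine mem_iUnion.2 ⟨(hw₂ ⟨y, hy⟩).choose, Fin.natAdd m (e ⟨y, hy⟩), ?_⟩
    simp only [c, w, Function.comp_apply, Fin.append_right, _root_.Equiv.symm_apply_apply]
    exact (hw₂ ⟨y, hy⟩).choose_spec

/-- First `A` is moved by `σ`, keeping the sequence, so that its copy relates to each `b i` as `A`
does to `b 0`; then everything is moved back by `σ.symm`. -/
theorem coheirChainCondition_indCK (hm : IsMonster L 𝕄 κ) :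
    CoheirChainCondition L κ (IndCK L : Relation 𝕄) := by
  intro M A ι b ht hι hb h
  have := hm.nonempty
  have hθ : ∀ i, ∃ θ : 𝕄 ≃[L] 𝕄, Fixes θ M ∧ θ ∘ b 0 = b i := fun i =>
    exists_equiv_of_sameType hm ht.model.2 (mk_range_lt (by simpa using hι)) (hb.sameType 0 i)
  choose θ hθ hθb using hθ
  have htC : IsTriple L κ M A (M ∪ ⋃ i, range (b i)) := ht.with_right subset_union_left
    (mk_union_lt hm ht.model.2 (mk_iUnion_range_lt hm (by simpa using hι) b))
  -- Expresses that, for every `i`, `x` satisfies the type of `A` over `M` and `b 0` transported to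
  -- `b i` by `θ i`.
  let 𝒢 : Filter (A → 𝕄) :=
    { sets := {W | ∃ D : Set (A → 𝕄), (M ∪ range (b 0)).Definable L D ∧
        (Subtype.val : A → 𝕄) ∈ D ∧ ∀ x : A → 𝕄, (∀ i, (θ i).symm ∘ x ∈ D) → x ∈ W}
      univ_sets := ⟨univ, definable_univ, mem_univ _, fun _ _ => mem_univ _⟩
      sets_of_superset := fun ⟨D, h1, h2, h3⟩ hW => ⟨D, h1, h2, fun x hx => hW (h3 x hx)⟩
      inter_sets := fun ⟨D, h1, h2, h3⟩ ⟨D', h1', h2', h3'⟩ => ⟨D ∩ D', h1.inter h1', ⟨h2, h2'⟩,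
        fun x hx => ⟨h3 x fun i => (hx i).1, h3' x fun i => (hx i).2⟩⟩ }
  obtain ⟨σ, hσ, hR, hD⟩ := exists_equiv_indCK hm htC 𝒢 (by
    rintro W ⟨D, hD, hmem, hDW⟩ n F hF hFb
    obtain ⟨σ, hσ, hσD, hσR⟩ := exists_equiv_chain hm ht hb hθ hθb (h (n + 1)) hD hmem hF hFb
    exact ⟨σ, hσ, hDW _ hσD, hσR⟩)
  have hρ : ∀ i, ∃ ρ : 𝕄 ≃[L] 𝕄, Fixes ρ (M ∪ range (b 0)) ∧
      ρ ∘ (Subtype.val : A → 𝕄) = (θ i).symm ∘ (σ ∘ (Subtype.val : A → 𝕄)) := by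
    intro i
    refine (sameType_val_iff hm ht.right_small ht.left_small).1 (sameType_of_imp ?_)
    intro D hDM hmem
    have hdef := Definable.image_equiv hDM (θ i)
    rw [image_union, (hθ i).image_eq, ← range_comp, hθb] at hdef
    exact hD {x | (θ i).symm ∘ x ∈ D} ⟨D, hDM, hmem, fun x hx => hx i⟩
      (hdef.mono (union_subset_union_right _ (subset_iUnion (fun i => range (b i)) i)))
  choose ρ hρ hρA using hρ
  refine ⟨fun i => σ.symm ∘ b i, hσ.symm.sameType _, fun n => ?_, fun i => ?_⟩
  · have := (isGood_iter hm n).invariance σ.symm _ _ _ (htC.image_left hσ) (hR n)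
    simp only [image_union, image_iUnion, ← range_comp, image_symm_image, hσ.symm.image_eq] at this
    exact this
  · have hτ : Fixes (σ.symm.comp ((θ i).comp (ρ i))) A := by
      intro x hx
      have h1 : ρ i x = (θ i).symm (σ x) := congrFun (hρA i) ⟨x, hx⟩
      simp [Language.Equiv.comp_apply, h1]
    have hτb : (σ.symm.comp ((θ i).comp (ρ i))) ∘ b 0 = σ.symm ∘ b i := by
      rw [coe_comp, coe_comp, ← hθb i]
      refine congrArg _ (congrArg _ ?_)
      exact funext fun k => hρ i _ (Or.inr ⟨k, rfl⟩)
    have := hτ.sameType (b 0)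
    rwa [hτb] at this

theorem isCanonicalCandidate_indCK (hm : IsMonster L 𝕄 κ) :
    IsCanonicalCandidate L κ (IndCK L : Relation 𝕄) where
  stronger _ _ _ _ h := h 0
  invariance σ M A B ht h n := (isGood_iter hm n).invariance σ M A B ht (h n)
  left_monotonicity M A A' B ht hM hA h n :=
    (isGood_iter hm n).left_monotonicity M A A' B ht hM hA (h n)
  right_monotonicity M A B B' ht hM hB h n :=
    (isGood_iter hm n).right_monotonicity M A B B' ht hM hB (h n)
  existence := existence_indCK hm
  right_extension := rightExtension_indCK hm
  coheir_chain := coheirChainCondition_indCK hm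

/-- The coheir chain condition for finite tuples. -/
theorem IsCanonicalCandidate.exists_equiv_chain {R : Relation 𝕄} (hm : IsMonster L 𝕄 κ)
    (hR : IsCanonicalCandidate L κ R) {n : ℕ} {c : ℕ → Fin n → 𝕄} (hc : IsCoheirMorley L M c)
    (ht : IsTriple L κ M A (M ∪ range (c 0))) (h : R M A (M ∪ range (c 0))) :
    ∃ ρ : 𝕄 ≃[L] 𝕄, Fixes ρ M ∧ R M A (M ∪ ⋃ i, range (ρ ∘ c i)) ∧
      ∀ i, SameType L A (c 0) (ρ ∘ c i) := by
  have := hm.nonempty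
  -- The chain condition quantifies over index types in the universe of `𝕄`.
  let b : ℕ → ULift.{w} (Fin n) → 𝕄 := fun i => c i ∘ ULift.down
  have hb : IsCoheirMorley L M b :=
    hc.subst (fun k : ULift.{w} (Fin n) => (Sum.inl k.down : Fin n ⊕ M))
  have hr : range (b 0) = range (c 0) := ULift.down_surjective.range_comp _
  rw [← hr] at ht h
  have hι : Cardinal.mk (ULift.{w} (Fin n)) < κ := Cardinal.mk_le_aleph0.trans_lt hm.aleph0_lt
  obtain ⟨b', hb', hb'R, hb'A⟩ := hR.coheir_chain M A (ULift.{w} (Fin n)) b ht hι hb h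
  obtain ⟨ρ, hρ, hρb⟩ := exists_equiv_of_sameType hm ht.model.2
    (mk_countable_lt hm (countable_range _)) hb'
  have hρb' : ∀ i, b' i ∘ ULift.up = ρ ∘ c i := fun i =>
    funext fun k => (congrFun hρb (i, ULift.up k)).symm
  have hr' : ∀ i, range (b' i) = range (ρ ∘ c i) := fun i => by
    rw [← hρb', ULift.up_surjective.range_comp]
  simp only [hr'] at hb'R
  refine ⟨ρ, hρ, hb'R, fun i => ?_⟩
  rw [← hρb']
  exact (hb'A i).comp ULift.up

/-- A candidate which is stronger than `S` is also stronger than the relation derived from `S`. -/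
theorem IsCanonicalCandidate.derived {R S : Relation 𝕄} (hm : IsMonster L 𝕄 κ)
    (hR : IsCanonicalCandidate L κ R)
    (hRS : ∀ M A B : Set 𝕄, IsTriple L κ M A B → R M A B → S M A B)
    (ht : IsTriple L κ M A B) (h : R M A B) : derived L S M A B := by
  have := hm.nonempty
  rintro n φ d hd hφ ⟨k, m, ψ, c, hdiv, himp⟩
  have hE : Cardinal.mk (B ∪ ⋃ j, range (c j) : Set 𝕄) < κ := mk_union_lt hm ht.right_small
    (mk_countable_lt hm (countable_iUnion fun _ => countable_range _))
  -- The parameters of the disjuncts need not lie in `B`, so independence is first extended to them.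
  obtain ⟨σ, hσ, hσR⟩ := hR.right_extension.exists_equiv hm ht subset_union_left hE h
  have hσM := hσ.mono ht.right
  have hσd : σ ∘ d = d := funext fun i => hσ _ (hd i)
  obtain ⟨j, hj⟩ := himp (σ ∘ Subtype.val) (by
    have := (realize_elim_comp φ σ _ _).2 hφ
    rwa [hσd] at this)
  obtain ⟨c', hc', hcc', hinc⟩ := hdiv j
  have htE := (ht.image_left hσM).with_right (ht.right.trans subset_union_left) hE
  have hsub : M ∪ range (c' 0) ⊆ B ∪ ⋃ j, range (c j) := by
    rw [hcc']
    exact union_subset_union ht.right (subset_iUnion (fun j => range (c j)) j)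
  obtain ⟨ρ, hρ, hρR, hρA⟩ := hR.exists_equiv_chain hm hc'
    (htE.subset_right subset_union_left hsub)
    (hR.right_monotonicity M _ _ _ htE subset_union_left hsub hσR)
  have hψ : ∀ i, (ψ j).Realize (Sum.elim (σ ∘ (Subtype.val : A → 𝕄)) (ρ ∘ c' i)) := by
    intro i
    obtain ⟨τ, hτ, hτc⟩ := exists_equiv_of_sameType hm (mk_image_lt σ ht.left_small)
      (mk_countable_lt hm (countable_range _)) (hρA i)
    have h1 : τ ∘ (σ ∘ (Subtype.val : A → 𝕄)) = σ ∘ Subtype.val :=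
      funext fun x => hτ _ ⟨x, x.2, rfl⟩
    rwa [← h1, ← hτc, realize_elim_comp, hcc']
  have htρ : IsTriple L κ M (σ '' A) (M ∪ ⋃ i, range (ρ ∘ c' i)) :=
    htE.with_right subset_union_left
      (mk_union_lt hm ht.model.2 (mk_countable_lt hm (countable_iUnion fun _ => countable_range _)))
  have hτM := hρ.symm.comp hσM
  have hst : SameType L M (Subtype.val : A → 𝕄) (ρ.symm ∘ (σ ∘ Subtype.val)) := hτM.sameType _
  -- The chain condition moved the sequence by `ρ`; undoing `ρ` on the left side gives the
  -- realization that dividing forbids.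
  refine hinc ⟨ρ.symm ∘ (σ ∘ Subtype.val), hst, ?_, fun i => ?_⟩
  · refine hRS _ _ _ (isTriple_of_sameType hm ht.model (by simpa using ht.left_small) hst c') ?_
    have h1 := hR.invariance ρ.symm _ _ _ htρ hρR
    simp only [image_union, image_iUnion, ← range_comp, hρ.symm.image_eq, symm_comp_comp] at h1
    have h2 : range (ρ.symm ∘ (σ ∘ (Subtype.val : A → 𝕄))) = ρ.symm '' (σ '' A) := by
      rw [range_comp, range_comp_val]
    rwa [h2, union_eq_right.2 (hρ.symm.subset_image (hσM.subset_image ht.left))]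
  · rw [realize_elim_comp_symm]
    exact hψ i

end Intersection

end CanonicalCoheir

theorem proposition3p1 {L : FirstOrder.Language.{u, v}} (T : L.Theory)
    (𝕄 : Type w) [L.Structure 𝕄] [Nonempty 𝕄] [𝕄 ⊨ T] (κ : Cardinal.{w})
    (hκ : Cardinal.aleph0 < κ)
    (hsat : CanonicalCoheir.IsSaturated L 𝕄 κ)
    (hhom : CanonicalCoheir.IsStronglyHomogeneous L 𝕄 κ) :
    CanonicalCoheir.IsCanonicalCandidate L κ
        (CanonicalCoheir.IndCK L : CanonicalCoheir.Relation 𝕄) ∧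
      ∀ R : CanonicalCoheir.Relation 𝕄, CanonicalCoheir.IsCanonicalCandidate L κ R →
        ∀ M A B : Set 𝕄, CanonicalCoheir.IsTriple L κ M A B →
          R M A B → CanonicalCoheir.IndCK L M A B := by
  have hm : CanonicalCoheir.IsMonster L 𝕄 κ := ⟨inferInstance, hκ, hsat, hhom⟩
  refine ⟨CanonicalCoheir.isCanonicalCandidate_indCK hm, fun R hR M A B ht h n => ?_⟩
  induction n generalizing M A B with
  | zero => exact hR.stronger M A B ht h
  | succ n ih => exact hR.derived hm ih ht h
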